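/- Let $H$ be a complex Hilbert space of dimension $2$ and let $p\in(1,\infty)\setminus\{2\}$ be a real number. Let $C_p(H)$ be the space of all linear operators $a$ on $H$ with the $p$-Schatten norm $\|a\|_p=\left(\sigma_1(a)^p+\sigma_2(a)^p\right)^{1/p}$, where $\sigma_1(a)\ge\sigma_2(a)\ge 0$ are the singular values of $a$, that is, the eigenvalues of $|a|=(a^*a)^{1/2}$ repeated according to multiplicity, and let $S(C_p(H))=\{a\in C_p(H):\|a\|_p=1\}$ be its unit sphere. Let $\Delta:S(C_p(H))\to S(C_p(H))$ be a surjective isometry, that is, a surjective map with $\|\Delta(a)-\Delta(b)\|_p=\|a-b\|_p$ for all $a,b\in S(C_p(H))$. Then there exists a surjective isometry $T:C_p(H)\to C_p(H)$ that is either complex linear or conjugate linear and whose restriction to $S(C_p(H))$ is $\Delta$. -/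

import Mathlib

/-- The `p`-Schatten norm `‖a‖_p = (∑ σ_n(a) ^ p) ^ (1 / p)` of an operator `a` on a finite-dimensional
complex Hilbert space `H`. The singular values `σ_n(a)` are Mathlib's `LinearMap.singularValues`: the
eigenvalues of `|a| = (a⋆ a) ^ (1 / 2)`, in decreasing order, repeated according to multiplicity, and
extended by `0` from the index `dim H` on. -/
noncomputable def schattenNorm {H : Type*} [NormedAddCommGroup H] [InnerProductSpace ℂ H]
    [FiniteDimensional ℂ H] (p : ℝ) (a : H →ₗ[ℂ] H) : ℝ :=
  (∑ n ∈ Finset.range (Module.finrank ℂ H), a.singularValues n ^ p) ^ (1 / p)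

/-- The unit sphere `S(C_p(H))`. As `H` has finite dimension, every linear operator on `H` is bounded,
compact and of `p`-Schatten class, so that `C_p(H)` is the space of all linear operators on `H`. -/
def schattenSphere (H : Type*) [NormedAddCommGroup H] [InnerProductSpace ℂ H]
    [FiniteDimensional ℂ H] (p : ℝ) : Set (H →ₗ[ℂ] H) :=
  {a | schattenNorm p a = 1}

/-! The 2 × 2 complex matrices with the determinant form a four-dimensional complex quadratic space.
In coordinates where the determinant is ∑ zᵢ², one has σ₁² + σ₂² = 2 `energy` and σ₁σ₂ = `disc`, so
these two quantities determine the Schatten norm. The argument follows Δ on the minimal partial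
isometries e (rank one, norm one). Each has an orthogonal partner `bar e`, and every operator is σ₁
e + σ₂ μ `bar e` with |μ| = 1 for a suitable e (`exists_svd`).

Strict convexity makes Δ odd (`eq_neg_of_schattenPow_sub`), so Δ preserves norms of sums as well as
of differences. For p ≠ 2, equality in the Clarkson-McCarthy inequality between unit vectors forces
determinant zero (`disc_eq_zero_of_clarkson`). The pair e, `bar e` attains equality, hence Δ maps
minimal partial isometries to minimal ones. The norms of e + f and e - f determine the real inner
product of e and f and the modulus of `pair e f` (`IsMinimal.ip_eq_and_norm_pair_eq`), so Δ
preserves both.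

Preserving the inner product makes Δ, on these elements, the restriction of a real linear isometry T
(`exists_linear_extension`). Preserving the modulus of `pair` makes T preserve |det|, hence the
Schatten norm (`disc_linear`), and makes T complex linear or conjugate linear (`linear_or_conj`).
Finally, by the equality case of Mirsky's inequality, a point of the sphere is determined by its
distances to the minimal partial isometries (`eq_of_forall_isMinimal`), so T agrees with Δ on the
whole sphere. -/

namespace SpinFactor

open ComplexConjugate Set

/-! ### Coordinates, forms and their algebra -/

/-- Four complex coordinates: the operators on a two-dimensional Hilbert space, with the determinant
as the quadratic form `∑ i, z i ^ 2`. -/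
abbrev Coord := Fin 4 → ℂ

/-- The complex bilinear form whose quadratic form is the determinant. -/
noncomputable def pair (z w : Coord) : ℂ := ∑ i, z i * w i

/-- The real inner product, one half of the real part of the Hilbert-Schmidt product. -/
noncomputable def ip (z w : Coord) : ℝ := ∑ i, ((z i).re * (w i).re + (z i).im * (w i).im)

/-- One half of the square of the Hilbert-Schmidt norm. -/
noncomputable def energy (z : Coord) : ℝ := ip z z

/-- The absolute value of the determinant. -/
noncomputable def disc (z : Coord) : ℝ := ‖pair z z‖

/-- One half of the difference of the squares of the singular values. -/
noncomputable def width (z : Coord) : ℝ := √(energy z ^ 2 - disc z ^ 2)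

/-- The larger singular value. -/
noncomputable def sv₁ (z : Coord) : ℝ := √(energy z + width z)

/-- The smaller singular value. -/
noncomputable def sv₂ (z : Coord) : ℝ := √(energy z - width z)

/-- The `p`-th power of the Schatten norm. -/
noncomputable def schattenPow (p : ℝ) (z : Coord) : ℝ := sv₁ z ^ p + sv₂ z ^ p

/-- Coordinatewise complex conjugation. -/
noncomputable def bar (z : Coord) : Coord := fun i => conj (z i)

/-- The traceless part of `a⋆ a`, as a vector of length `width`. -/
noncomputable def moment (z : Coord) : EuclideanSpace ℝ (Fin 3) :=
  WithLp.toLp 2 ![2 * ((z 0).re * (z 1).im - (z 0).im * (z 1).re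
      + ((z 2).re * (z 3).im - (z 2).im * (z 3).re)),
    2 * ((z 0).re * (z 2).im - (z 0).im * (z 2).re
      - ((z 1).re * (z 3).im - (z 1).im * (z 3).re)),
    2 * ((z 0).re * (z 3).im - (z 0).im * (z 3).re
      + ((z 1).re * (z 2).im - (z 1).im * (z 2).re))]

theorem pair_comm (z w : Coord) : pair z w = pair w z := by
  simp only [pair, mul_comm]

theorem ip_comm (z w : Coord) : ip z w = ip w z := by
  simp only [ip, mul_comm]

theorem pair_add_left (x y z : Coord) : pair (x + y) z = pair x z + pair y z := by
  simp [pair, add_mul, Finset.sum_add_distrib]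

theorem pair_smul_left (c : ℂ) (x z : Coord) : pair (c • x) z = c * pair x z := by
  simp [pair, Finset.mul_sum, mul_assoc]

theorem pair_add_right (x y z : Coord) : pair x (y + z) = pair x y + pair x z := by
  rw [pair_comm, pair_add_left, pair_comm y, pair_comm z]

theorem pair_smul_right (c : ℂ) (x z : Coord) : pair x (c • z) = c * pair x z := by
  rw [pair_comm, pair_smul_left, pair_comm]

theorem ip_add_left (x y z : Coord) : ip (x + y) z = ip x z + ip y z := by
  simp only [ip, ← Finset.sum_add_distrib]
  refine Finset.sum_congr rfl fun i _ => ?_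
  simp; ring

theorem ip_add_right (x y z : Coord) : ip x (y + z) = ip x y + ip x z := by
  rw [ip_comm, ip_add_left, ip_comm y, ip_comm z]

theorem ip_smul_left (c : ℝ) (x z : Coord) : ip (c • x) z = c * ip x z := by
  simp only [ip, Finset.mul_sum]
  refine Finset.sum_congr rfl fun i _ => ?_
  simp; ring

theorem ip_smul_right (c : ℝ) (x z : Coord) : ip x (c • z) = c * ip x z := by
  rw [ip_comm, ip_smul_left, ip_comm]

theorem ip_neg_left (x z : Coord) : ip (-x) z = - ip x z := by
  have := ip_smul_left (-1) x z
  simpa using this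

theorem ip_sub_left (x y z : Coord) : ip (x - y) z = ip x z - ip y z := by
  rw [sub_eq_add_neg, ip_add_left, ip_neg_left, sub_eq_add_neg]

theorem ip_sub_right (x y z : Coord) : ip x (y - z) = ip x y - ip x z := by
  rw [ip_comm, ip_sub_left, ip_comm y, ip_comm z]

theorem ip_sum_left {ι : Type*} (s : Finset ι) (f : ι → Coord) (z : Coord) :
    ip (∑ k ∈ s, f k) z = ∑ k ∈ s, ip (f k) z := by
  classical
  induction s using Finset.induction_on with
  | empty => simp [ip]
  | insert a s ha ih => rw [Finset.sum_insert ha, Finset.sum_insert ha, ip_add_left, ih]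

theorem energy_add (x y : Coord) : energy (x + y) = energy x + 2 * ip x y + energy y := by
  simp only [energy, ip_add_left, ip_add_right, ip_comm y x]; ring

theorem energy_sub (x y : Coord) : energy (x - y) = energy x - 2 * ip x y + energy y := by
  simp only [energy, ip_sub_left, ip_sub_right, ip_comm y x]; ring

theorem energy_nonneg (z : Coord) : 0 ≤ energy z := by
  unfold energy ip
  exact Finset.sum_nonneg fun i _ => add_nonneg (mul_self_nonneg (z i).re) (mul_self_nonneg (z i).im)

theorem energy_eq_zero {z : Coord} (h : energy z = 0) : z = 0 := by
  rw [energy, ip, Finset.sum_eq_zero_iff_of_nonneg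
    (fun i _ => add_nonneg (mul_self_nonneg (z i).re) (mul_self_nonneg (z i).im))] at h
  ext i
  rw [Pi.zero_apply, ← Complex.normSq_eq_zero, Complex.normSq_apply]
  exact h i (Finset.mem_univ i)

theorem energy_smul (c : ℂ) (z : Coord) : energy (c • z) = ‖c‖ ^ 2 * energy z := by
  simp only [energy, ip, Complex.sq_norm, Complex.normSq_apply, Finset.mul_sum]
  refine Finset.sum_congr rfl fun i _ => ?_
  simp; ring

theorem ip_smul_smul (c : ℂ) (z w : Coord) : ip (c • z) (c • w) = ‖c‖ ^ 2 * ip z w := by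
  simp only [ip, Complex.sq_norm, Complex.normSq_apply, Finset.mul_sum]
  refine Finset.sum_congr rfl fun i _ => ?_
  simp; ring

theorem disc_smul (c : ℂ) (z : Coord) : disc (c • z) = ‖c‖ ^ 2 * disc z := by
  simp only [disc, pair_smul_left, pair_smul_right, norm_mul]; ring

theorem disc_nonneg (z : Coord) : 0 ≤ disc z := norm_nonneg _

theorem pair_bar (z w : Coord) : (pair z (bar w)).re = ip z w := by
  simp [pair, bar, ip]

theorem pair_bar_self (z : Coord) : pair z (bar z) = energy z := by
  apply Complex.ext
  · rw [pair_bar]; simp [energy]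
  · simp [pair, bar]
    refine Finset.sum_eq_zero fun i _ => ?_
    ring

theorem bar_bar (z : Coord) : bar (bar z) = z := by
  ext i; simp [bar]

theorem bar_smul (c : ℂ) (z : Coord) : bar (c • z) = conj c • bar z := by
  ext i; simp [bar]

theorem energy_bar (z : Coord) : energy (bar z) = energy z := by
  simp [energy, ip, bar]

theorem pair_bar_bar (z w : Coord) : pair (bar z) (bar w) = conj (pair z w) := by
  simp [pair, bar]

theorem ip_self_smul_bar (c : ℂ) (x y : Coord) :
    ip x (c • bar y) = (conj c * pair x y).re := by
  rw [← pair_bar, bar_smul, bar_bar, pair_smul_right]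

/-! ### Singular values from energy and determinant -/

/-- This is det(a⋆a) = |det a|²: a⋆a is `energy` times the identity plus a traceless part of length
‖moment‖. It turns `width` into a norm of a vector, for which triangle inequalities are available.
-/
theorem norm_moment_sq (z : Coord) : ‖moment z‖ ^ 2 = energy z ^ 2 - disc z ^ 2 := by
  rw [EuclideanSpace.norm_sq_eq, disc, Complex.sq_norm, Complex.normSq_apply]
  simp only [moment, energy, ip, pair, Fin.sum_univ_three, Fin.sum_univ_four, Real.norm_eq_abs,
    sq_abs, Complex.add_re, Complex.add_im, Complex.mul_re, Complex.mul_im, Matrix.cons_val]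
  ring

theorem norm_moment (z : Coord) : ‖moment z‖ = width z := by
  rw [width, ← norm_moment_sq, Real.sqrt_sq (norm_nonneg _)]

theorem disc_le_energy (z : Coord) : disc z ≤ energy z := by
  have := norm_moment_sq z
  exact abs_le_of_sq_le_sq' (by nlinarith [sq_nonneg ‖moment z‖]) (energy_nonneg z) |>.2

theorem width_sq (z : Coord) : width z ^ 2 = energy z ^ 2 - disc z ^ 2 := by
  rw [← norm_moment, norm_moment_sq]

theorem width_nonneg (z : Coord) : 0 ≤ width z := Real.sqrt_nonneg _

theorem width_le_energy (z : Coord) : width z ≤ energy z := by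
  refine abs_le_of_sq_le_sq' ?_ (energy_nonneg z) |>.2
  rw [width_sq]; nlinarith [sq_nonneg (disc z)]

theorem sv₁_nonneg (z : Coord) : 0 ≤ sv₁ z := Real.sqrt_nonneg _

theorem sv₂_nonneg (z : Coord) : 0 ≤ sv₂ z := Real.sqrt_nonneg _

theorem sv₁_sq (z : Coord) : sv₁ z ^ 2 = energy z + width z :=
  Real.sq_sqrt (add_nonneg (energy_nonneg z) (width_nonneg z))

theorem sv₂_sq (z : Coord) : sv₂ z ^ 2 = energy z - width z :=
  Real.sq_sqrt (sub_nonneg.2 (width_le_energy z))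

theorem sv₂_le_sv₁ (z : Coord) : sv₂ z ≤ sv₁ z :=
  Real.sqrt_le_sqrt (by linarith [width_nonneg z])

theorem sv_sq_add (z : Coord) : sv₁ z ^ 2 + sv₂ z ^ 2 = 2 * energy z := by
  rw [sv₁_sq, sv₂_sq]; ring

theorem sv_mul (z : Coord) : sv₁ z * sv₂ z = disc z := by
  refine (sq_eq_sq₀ (mul_nonneg (sv₁_nonneg z) (sv₂_nonneg z)) (disc_nonneg z)).1 ?_
  rw [mul_pow, sv₁_sq, sv₂_sq]
  linear_combination -width_sq z

/-- The sum and the product of the squares determine the two singular values. -/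
theorem eq_and_eq_of_sq_add_of_mul {a b x y : ℝ} (hb : 0 ≤ b) (hba : b ≤ a) (hy : 0 ≤ y)
    (hyx : y ≤ x) (h1 : a ^ 2 + b ^ 2 = x ^ 2 + y ^ 2) (h2 : a * b = x * y) : a = x ∧ b = y := by
  have h3 : a + b = x + y := by
    refine (sq_eq_sq₀ (by linarith) (by linarith)).1 (by nlinarith)
  have h4 : a - b = x - y := by
    refine (sq_eq_sq₀ (by linarith) (by linarith)).1 (by nlinarith)
  constructor <;> linarith

theorem sv_eq {z : Coord} {x y : ℝ} (hy : 0 ≤ y) (hyx : y ≤ x)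
    (h1 : x ^ 2 + y ^ 2 = 2 * energy z) (h2 : x * y = disc z) : sv₁ z = x ∧ sv₂ z = y :=
  eq_and_eq_of_sq_add_of_mul (sv₂_nonneg z) (sv₂_le_sv₁ z) hy hyx
    ((sv_sq_add z).trans h1.symm) ((sv_mul z).trans h2.symm)

theorem schattenPow_eq {p : ℝ} {z : Coord} {x y : ℝ} (hx : 0 ≤ x) (hy : 0 ≤ y)
    (h1 : x ^ 2 + y ^ 2 = 2 * energy z) (h2 : x * y = disc z) :
    schattenPow p z = x ^ p + y ^ p := by
  rcases le_total y x with h | h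
  · obtain ⟨h3, h4⟩ := sv_eq hy h h1 h2
    rw [schattenPow, h3, h4]
  · obtain ⟨h3, h4⟩ := sv_eq hx h (by linarith) (by linarith)
    rw [schattenPow, h3, h4, add_comm]

theorem sv_congr {z w : Coord} (h1 : energy z = energy w) (h2 : disc z = disc w) :
    sv₁ z = sv₁ w ∧ sv₂ z = sv₂ w := by
  simp [sv₁, sv₂, width, h1, h2]

theorem schattenPow_congr {p : ℝ} {z w : Coord} (h1 : energy z = energy w)
    (h2 : disc z = disc w) : schattenPow p z = schattenPow p w := by
  rw [schattenPow, schattenPow, (sv_congr h1 h2).1, (sv_congr h1 h2).2]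

theorem sv_smul (c : ℂ) (z : Coord) :
    sv₁ (c • z) = ‖c‖ * sv₁ z ∧ sv₂ (c • z) = ‖c‖ * sv₂ z := by
  refine sv_eq (mul_nonneg (norm_nonneg c) (sv₂_nonneg z))
    (mul_le_mul_of_nonneg_left (sv₂_le_sv₁ z) (norm_nonneg c)) ?_ ?_
  · rw [energy_smul]; linear_combination ‖c‖ ^ 2 * sv_sq_add z
  · rw [disc_smul]; linear_combination ‖c‖ ^ 2 * sv_mul z

theorem schattenPow_smul (p : ℝ) (c : ℂ) (z : Coord) :
    schattenPow p (c • z) = ‖c‖ ^ p * schattenPow p z := by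
  rw [schattenPow, (sv_smul c z).1, (sv_smul c z).2, Real.mul_rpow (norm_nonneg c) (sv₁_nonneg z),
    Real.mul_rpow (norm_nonneg c) (sv₂_nonneg z), schattenPow, mul_add]

theorem schattenPow_neg (p : ℝ) (z : Coord) : schattenPow p (-z) = schattenPow p z := by
  simpa using schattenPow_smul p (-1) z

theorem schattenPow_zero {p : ℝ} (hp : p ≠ 0) : schattenPow p 0 = 0 := by
  simpa [Real.zero_rpow hp] using schattenPow_smul p 0 0

theorem energy_pos_of_schattenPow {p : ℝ} (hp : p ≠ 0) {z : Coord} (h : schattenPow p z = 1) :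
    0 < energy z := by
  refine (energy_nonneg z).lt_of_ne' fun h0 => ?_
  rw [energy_eq_zero h0, schattenPow_zero hp] at h
  exact zero_ne_one h

/-! ### Minimal partial isometries -/

/-- The minimal partial isometries: the operators of rank one and norm one. -/
def IsMinimal (e : Coord) : Prop := pair e e = 0 ∧ energy e = 1 / 2

theorem IsMinimal.smul {e : Coord} (he : IsMinimal e) {c : ℂ} (hc : ‖c‖ = 1) :
    IsMinimal (c • e) := by
  refine ⟨?_, ?_⟩
  · rw [pair_smul_left, pair_smul_right, he.1]; simp
  · rw [energy_smul, hc, he.2]; simp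

theorem IsMinimal.bar {e : Coord} (he : IsMinimal e) : IsMinimal (bar e) :=
  ⟨by rw [pair_bar_bar, he.1, map_zero], by rw [energy_bar, he.2]⟩

theorem IsMinimal.schattenPow {e : Coord} (he : IsMinimal e) {p : ℝ} (hp : p ≠ 0) :
    schattenPow p e = 1 := by
  rw [schattenPow_eq (x := 1) (y := 0) zero_le_one le_rfl (by rw [he.2]; norm_num)
    (by simp [disc, he.1]), Real.one_rpow, Real.zero_rpow hp, add_zero]

theorem isMinimal_of_disc_eq_zero {p : ℝ} (hp : 0 < p) {z : Coord} (h : disc z = 0)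
    (h1 : SpinFactor.schattenPow p z = 1) : IsMinimal z := by
  refine ⟨norm_eq_zero.1 h, ?_⟩
  have hs : √(2 * energy z) ^ 2 = 2 * energy z :=
    Real.sq_sqrt (by linarith [energy_nonneg z])
  rw [schattenPow_eq (x := √(2 * energy z)) (y := 0) (Real.sqrt_nonneg _) le_rfl
    (by rw [hs]; ring) (by rw [h]; simp), Real.zero_rpow hp.ne', add_zero] at h1
  have : √(2 * energy z) = 1 := by
    rwa [← Real.rpow_left_inj (Real.sqrt_nonneg _) zero_le_one hp.ne', Real.one_rpow]
  rw [this] at hs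
  linarith

/-- The operators e and `bar e` have orthogonal initial spaces and orthogonal final spaces, so the
singular values of the combination are |α| and |β|. -/
theorem schattenPow_smul_add_smul_bar {e : Coord} (he : IsMinimal e) (p : ℝ) (α β : ℂ) :
    schattenPow p (α • e + β • bar e) = ‖α‖ ^ p + ‖β‖ ^ p := by
  refine schattenPow_eq (norm_nonneg α) (norm_nonneg β) ?_ ?_
  · have : ip (α • e) (β • bar e) = 0 := by
      rw [ip_self_smul_bar, pair_smul_left, he.1]; simp
    rw [energy_add, energy_smul, energy_smul, energy_bar, he.2, this]; ring
  · simp only [disc, pair_add_left, pair_add_right, pair_smul_left, pair_smul_right,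
      pair_bar_bar, he.1, pair_comm (SpinFactor.bar e) e, pair_bar_self, he.2]
    have : α * (α * 0 + β * ((1 / 2 : ℝ) : ℂ)) + β * (α * ((1 / 2 : ℝ) : ℂ)
        + β * conj (0 : ℂ)) = α * β := by
      push_cast; simp; ring
    rw [this, norm_mul]

/-! ### Real and imaginary parts, trace norm and singular value decomposition -/

/-- The real part, in the Euclidean space of dimension four. -/
noncomputable def rePart (z : Coord) : EuclideanSpace ℝ (Fin 4) :=
  WithLp.toLp 2 fun i => (z i).re

/-- The imaginary part, in the Euclidean space of dimension four. -/
noncomputable def imPart (z : Coord) : EuclideanSpace ℝ (Fin 4) :=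
  WithLp.toLp 2 fun i => (z i).im

theorem rePart_add (z w : Coord) : rePart (z + w) = rePart z + rePart w := by
  ext i; simp [rePart]

theorem rePart_I_smul (z : Coord) : rePart (Complex.I • z) = -imPart z := by
  ext i; simp [rePart, imPart]

theorem norm_rePart_sq (z : Coord) : 2 * ‖rePart z‖ ^ 2 = energy z + (pair z z).re := by
  rw [EuclideanSpace.norm_sq_eq]
  simp [rePart, energy, ip, pair, Fin.sum_univ_four]; ring

theorem norm_imPart_sq (z : Coord) : 2 * ‖imPart z‖ ^ 2 = energy z - (pair z z).re := by
  rw [EuclideanSpace.norm_sq_eq]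
  simp [imPart, energy, ip, pair, Fin.sum_univ_four]; ring

theorem inner_rePart_imPart (z : Coord) : 2 * inner ℝ (rePart z) (imPart z) = (pair z z).im := by
  simp [rePart, imPart, pair, Fin.sum_univ_four, PiLp.inner_apply]; ring

theorem ip_eq_inner (z w : Coord) :
    ip z w = inner ℝ (rePart z) (rePart w) + inner ℝ (imPart z) (imPart w) := by
  simp [rePart, imPart, ip, Fin.sum_univ_four, PiLp.inner_apply]; ring

/-- Rotating by minus half the argument of the determinant makes it nonnegative. The real and
imaginary parts then become orthogonal, with lengths (σ₁ ± σ₂)/2. -/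
theorem exists_phase (z : Coord) :
    ∃ c : ℂ, ‖c‖ = 1 ∧ pair (c • z) (c • z) = disc z := by
  have h := Complex.norm_mul_exp_arg_mul_I (pair z z)
  generalize (pair z z).arg = θ at h
  refine ⟨Complex.exp ((-(θ / 2) : ℝ) * Complex.I), Complex.norm_exp_ofReal_mul_I _, ?_⟩
  have h0 : Complex.exp ((-(θ / 2) : ℝ) * Complex.I) * Complex.exp ((-(θ / 2) : ℝ) * Complex.I)
      * Complex.exp (θ * Complex.I) = 1 := by
    rw [← Complex.exp_add, ← Complex.exp_add, ← Complex.exp_zero]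
    congr 1
    push_cast; ring
  rw [pair_smul_left, pair_smul_right, disc]
  linear_combination -(Complex.exp ((-(θ / 2) : ℝ) * Complex.I)) ^ 2 * h
    + (‖pair z z‖ : ℂ) * h0

theorem sv_add_sq (z : Coord) : (sv₁ z + sv₂ z) ^ 2 = 2 * (energy z + disc z) := by
  linear_combination sv_sq_add z + 2 * sv_mul z

theorem sv_sub_sq (z : Coord) : (sv₁ z - sv₂ z) ^ 2 = 2 * (energy z - disc z) := by
  linear_combination sv_sq_add z - 2 * sv_mul z

/-- With the equality at the phase of `exists_phase`, this exhibits the trace norm as the maximum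
over unimodular c of 2‖Re(cz)‖. -/
theorem two_mul_norm_rePart_le (z : Coord) : 2 * ‖rePart z‖ ≤ sv₁ z + sv₂ z := by
  refine abs_le_of_sq_le_sq' ?_ (add_nonneg (sv₁_nonneg z) (sv₂_nonneg z)) |>.2
  rw [sv_add_sq, mul_pow]
  have : (pair z z).re ≤ disc z := Complex.re_le_norm _
  linarith [norm_rePart_sq z]

theorem le_two_mul_norm_rePart (z : Coord) : sv₁ z - sv₂ z ≤ 2 * ‖rePart z‖ := by
  refine abs_le_of_sq_le_sq' ?_ (by positivity) |>.2
  rw [sv_sub_sq, mul_pow]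
  have : -(pair z z).re ≤ disc z := (neg_le_abs _).trans (Complex.abs_re_le_norm _)
  linarith [norm_rePart_sq z]

theorem two_mul_norm_rePart_eq {z : Coord} (h : pair z z = disc z) :
    2 * ‖rePart z‖ = sv₁ z + sv₂ z := by
  refine (sq_eq_sq₀ (by positivity) (add_nonneg (sv₁_nonneg z) (sv₂_nonneg z))).1 ?_
  have h1 := norm_rePart_sq z
  rw [h, Complex.ofReal_re] at h1
  rw [sv_add_sq]; linarith

theorem two_mul_norm_imPart_eq {z : Coord} (h : pair z z = disc z) :
    2 * ‖imPart z‖ = sv₁ z - sv₂ z := by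
  refine (sq_eq_sq₀ (by positivity) (sub_nonneg.2 (sv₂_le_sv₁ z))).1 ?_
  have h1 := norm_imPart_sq z
  rw [h, Complex.ofReal_re] at h1
  rw [sv_sub_sq]; linarith

theorem sv_smul_of_norm_eq_one {c : ℂ} (hc : ‖c‖ = 1) (z : Coord) :
    sv₁ (c • z) = sv₁ z ∧ sv₂ (c • z) = sv₂ z := by
  simpa [hc] using sv_smul c z

theorem disc_smul_of_norm_eq_one {c : ℂ} (hc : ‖c‖ = 1) (z : Coord) :
    disc (c • z) = disc z := by
  simp [disc_smul, hc]

/-- The triangle inequality of the trace norm. -/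
theorem sv_add_le (z w : Coord) : sv₁ (z + w) + sv₂ (z + w) ≤ sv₁ z + sv₂ z + (sv₁ w + sv₂ w) := by
  obtain ⟨c, hc, h⟩ := exists_phase (z + w)
  have h1 := two_mul_norm_rePart_eq (z := c • (z + w)) (by rw [h, disc_smul_of_norm_eq_one hc])
  rw [(sv_smul_of_norm_eq_one hc _).1, (sv_smul_of_norm_eq_one hc _).2, smul_add, rePart_add] at h1
  have h2 := two_mul_norm_rePart_le (c • z)
  have h3 := two_mul_norm_rePart_le (c • w)
  rw [(sv_smul_of_norm_eq_one hc _).1, (sv_smul_of_norm_eq_one hc _).2] at h2 h3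
  linarith [norm_add_le (rePart (c • z)) (rePart (c • w))]

/-- At the phase where the determinant of z is nonnegative, multiplication by i turns the imaginary
part, of length (σ₁ - σ₂)/2, into a real part. There the gap of z + w is bounded by 2‖Re‖, and the
triangle inequality in ℝ⁴ applies. -/
theorem sv_gap_add_le (z w : Coord) : sv₁ (z + w) - sv₂ (z + w) ≤ sv₁ z - sv₂ z + (sv₁ w + sv₂ w) := by
  obtain ⟨c, hc, h⟩ := exists_phase z
  have hc' : ‖Complex.I * c‖ = 1 := by simp [hc]
  have h1 := two_mul_norm_imPart_eq (z := c • z) (by rw [h, disc_smul_of_norm_eq_one hc])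
  rw [(sv_smul_of_norm_eq_one hc _).1, (sv_smul_of_norm_eq_one hc _).2, ← norm_neg, ← rePart_I_smul,
    smul_smul] at h1
  have h2 := two_mul_norm_rePart_le ((Complex.I * c) • w)
  have h3 := le_two_mul_norm_rePart ((Complex.I * c) • (z + w))
  rw [(sv_smul_of_norm_eq_one hc' _).1, (sv_smul_of_norm_eq_one hc' _).2] at h2 h3
  rw [smul_add, rePart_add] at h3
  linarith [norm_add_le (rePart ((Complex.I * c) • z)) (rePart ((Complex.I * c) • w))]

theorem IsMinimal.norm_rePart {e : Coord} (he : IsMinimal e) : ‖rePart e‖ = 1 / 2 := by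
  have h := norm_rePart_sq e
  rw [he.1, he.2, Complex.zero_re] at h
  refine (sq_eq_sq₀ (norm_nonneg _) (by norm_num)).1 (by linarith)

theorem IsMinimal.norm_imPart {e : Coord} (he : IsMinimal e) : ‖imPart e‖ = 1 / 2 := by
  have h := norm_imPart_sq e
  rw [he.1, he.2, Complex.zero_re] at h
  refine (sq_eq_sq₀ (norm_nonneg _) (by norm_num)).1 (by linarith)

/-- After the phase rotation σ₁ = ‖Re z‖ + ‖Im z‖, while both parts of a minimal element have length
1/2; Cauchy-Schwarz applies to each part separately. -/
theorem two_mul_ip_le {e : Coord} (he : IsMinimal e) (z : Coord) : 2 * ip z e ≤ sv₁ z := by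
  obtain ⟨c, hc, h⟩ := exists_phase z
  rw [← disc_smul_of_norm_eq_one hc] at h
  have h1 := two_mul_norm_rePart_eq h
  have h2 := two_mul_norm_imPart_eq h
  have h3 := ip_smul_smul c z e
  have hg := he.smul hc
  rw [ip_eq_inner, hc] at h3
  have h4 := real_inner_le_norm (rePart (c • z)) (rePart (c • e))
  have h5 := real_inner_le_norm (imPart (c • z)) (imPart (c • e))
  rw [hg.norm_rePart] at h4
  rw [hg.norm_imPart] at h5
  rw [← (sv_smul_of_norm_eq_one hc z).1]
  linarith

/-- A minimal partial isometry at which the operator norm is attained is the first term of a singular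
value decomposition. -/
theorem eq_of_two_mul_ip_eq {e : Coord} (he : IsMinimal e) {z : Coord} (hz : 2 * ip z e = sv₁ z) :
    ∃ μ : ℂ, ‖μ‖ = 1 ∧ z = (sv₁ z : ℂ) • e + (sv₂ z * μ) • bar e := by
  obtain ⟨c, hc, h⟩ := exists_phase z
  rw [← disc_smul_of_norm_eq_one hc] at h
  have h1 := two_mul_norm_rePart_eq h
  have h2 := two_mul_norm_imPart_eq h
  have h3 := ip_smul_smul c z e
  have hg := he.smul hc
  rw [ip_eq_inner, hc] at h3
  have h4 := real_inner_le_norm (rePart (c • z)) (rePart (c • e))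
  have h5 := real_inner_le_norm (imPart (c • z)) (imPart (c • e))
  rw [hg.norm_rePart] at h4
  rw [hg.norm_imPart] at h5
  rw [(sv_smul_of_norm_eq_one hc z).1, (sv_smul_of_norm_eq_one hc z).2] at h1 h2
  have h6 : inner ℝ (rePart (c • z)) (rePart (c • e)) = ‖rePart (c • z)‖ * ‖rePart (c • e)‖ := by
    rw [hg.norm_rePart]; linarith
  have h7 : inner ℝ (imPart (c • z)) (imPart (c • e)) = ‖imPart (c • z)‖ * ‖imPart (c • e)‖ := by
    rw [hg.norm_imPart]; linarith
  rw [inner_eq_norm_mul_iff_real, hg.norm_rePart] at h6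
  rw [inner_eq_norm_mul_iff_real, hg.norm_imPart] at h7
  have hcc : conj c * c = 1 := by
    rw [← Complex.normSq_eq_conj_mul_self, Complex.normSq_eq_norm_sq, hc]; simp
  -- Undoing the rotation contributes one factor `conj c`, and `bar (c • e) = conj c • bar e`
  -- contributes the other.
  refine ⟨conj c * conj c, by simp [hc], ?_⟩
  have key : c • z = (sv₁ z : ℂ) • (c • e) + (sv₂ z : ℂ) • bar (c • e) := by
    ext i
    have h8 := congrArg (fun v : EuclideanSpace ℝ (Fin 4) => v i) h6
    have h9 := congrArg (fun v : EuclideanSpace ℝ (Fin 4) => v i) h7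
    simp only [rePart, imPart, PiLp.smul_apply, smul_eq_mul] at h8 h9
    apply Complex.ext
    · simp only [bar, Pi.add_apply, Pi.smul_apply (sv₁ z : ℂ), Pi.smul_apply (sv₂ z : ℂ),
        smul_eq_mul, Complex.add_re, Complex.re_ofReal_mul, Complex.conj_re]
      simp only [rePart] at h1
      linear_combination 2 * h8 + h1 * ((c • e) i).re
    · simp only [bar, Pi.add_apply, Pi.smul_apply (sv₁ z : ℂ), Pi.smul_apply (sv₂ z : ℂ),
        smul_eq_mul, Complex.add_im, Complex.im_ofReal_mul, Complex.conj_im]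
      simp only [imPart] at h2
      linear_combination 2 * h9 + h2 * ((c • e) i).im
  calc z = conj c • (c • z) := by rw [smul_smul, hcc, one_smul]
    _ = _ := by
      rw [key, bar_smul, smul_add, smul_smul, smul_smul, smul_smul, smul_smul]
      congr 2
      · linear_combination (sv₁ z : ℂ) * hcc
      · ring

theorem exists_unit_smul_eq (P : EuclideanSpace ℝ (Fin 4)) :
    ∃ u : EuclideanSpace ℝ (Fin 4), ‖u‖ = 1 ∧ P = ‖P‖ • u := by
  by_cases hP : P = 0
  · exact ⟨EuclideanSpace.single 0 1, by simp, by simp [hP]⟩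
  · exact ⟨‖P‖⁻¹ • P, norm_smul_inv_norm hP, by
      rw [smul_smul, mul_inv_cancel₀ (norm_ne_zero_iff.2 hP), one_smul]⟩

theorem exists_orthogonal_unit {u : EuclideanSpace ℝ (Fin 4)} (hu : ‖u‖ = 1) :
    ∃ v : EuclideanSpace ℝ (Fin 4), ‖v‖ = 1 ∧ inner ℝ u v = 0 := by
  refine ⟨WithLp.toLp 2 ![-u 1, u 0, -u 3, u 2], ?_, ?_⟩
  · rw [← hu, ← sq_eq_sq₀ (norm_nonneg _) (norm_nonneg _), EuclideanSpace.norm_sq_eq,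
      EuclideanSpace.norm_sq_eq]
    simp [Fin.sum_univ_four]; ring
  · simp [Fin.sum_univ_four, PiLp.inner_apply]; ring

/-- A vanishing P or Q has no direction of its own, so any unit vector orthogonal to the other
direction is substituted. -/
theorem exists_orthonormal_frame {P Q : EuclideanSpace ℝ (Fin 4)} (h : inner ℝ P Q = 0) :
    ∃ u v : EuclideanSpace ℝ (Fin 4), ‖u‖ = 1 ∧ ‖v‖ = 1 ∧ inner ℝ u v = 0 ∧
      P = ‖P‖ • u ∧ Q = ‖Q‖ • v := by
  obtain ⟨u, hu, hPu⟩ := exists_unit_smul_eq P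
  obtain ⟨v, hv, hQv⟩ := exists_unit_smul_eq Q
  by_cases hQ : Q = 0
  · obtain ⟨v', hv', huv⟩ := exists_orthogonal_unit hu
    exact ⟨u, v', hu, hv', huv, hPu, by simp [hQ]⟩
  by_cases hP : P = 0
  · obtain ⟨u', hu', huv⟩ := exists_orthogonal_unit hv
    exact ⟨u', v, hu', hv, by rw [real_inner_comm, huv], by simp [hP], hQv⟩
  · refine ⟨u, v, hu, hv, ?_, hPu, hQv⟩
    rw [hPu, hQv, real_inner_smul_left, real_inner_smul_right] at h
    simpa [hP, hQ] using h

theorem exists_two_mul_ip_eq (z : Coord) : ∃ e, IsMinimal e ∧ 2 * ip z e = sv₁ z := by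
  obtain ⟨c, hc, h⟩ := exists_phase z
  rw [← disc_smul_of_norm_eq_one hc] at h
  have h1 := two_mul_norm_rePart_eq h
  have h2 := two_mul_norm_imPart_eq h
  rw [(sv_smul_of_norm_eq_one hc z).1, (sv_smul_of_norm_eq_one hc z).2] at h1 h2
  have h3 : inner ℝ (rePart (c • z)) (imPart (c • z)) = 0 := by
    have := inner_rePart_imPart (c • z)
    rw [h, Complex.ofReal_im] at this
    linarith
  obtain ⟨u, v, hu, hv, huv, hPu, hQv⟩ := exists_orthonormal_frame h3
  have hcc : ‖conj c‖ = 1 := by simp [hc]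
  have hc1 : c * conj c = 1 := by
    rw [Complex.mul_conj, Complex.normSq_eq_norm_sq, hc]; simp
  -- Orthogonal parts of equal length 1/2 make g minimal, and being parallel to the parts of c • z
  -- gives equality in both Cauchy-Schwarz estimates.
  set g : Coord := fun i => ⟨u i / 2, v i / 2⟩ with hgdef
  have hgr : rePart g = (1 / 2 : ℝ) • u := by
    ext i; simp [rePart, hgdef]; ring
  have hgi : imPart g = (1 / 2 : ℝ) • v := by
    ext i; simp [imPart, hgdef]; ring
  have e1 := norm_rePart_sq g
  have e2 := norm_imPart_sq g
  have e3 := inner_rePart_imPart g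
  rw [hgr, norm_smul, hu] at e1
  rw [hgi, norm_smul, hv] at e2
  rw [hgr, hgi, real_inner_smul_left, real_inner_smul_right, huv] at e3
  norm_num at e1 e2 e3
  have hg : IsMinimal g := by
    refine ⟨Complex.ext ?_ e3.symm, by linarith⟩
    rw [Complex.zero_re]; linarith
  refine ⟨conj c • g, hg.smul hcc, ?_⟩
  have h4 := ip_smul_smul c z (conj c • g)
  rw [smul_smul, hc1, one_smul, hc, ip_eq_inner, hgr, hgi] at h4
  nth_rewrite 1 [hPu] at h4
  nth_rewrite 1 [hQv] at h4
  simp only [real_inner_smul_left, real_inner_smul_right, real_inner_self_eq_norm_sq, hu, hv] at h4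
  linarith

theorem sv₁_add_le (z w : Coord) : sv₁ (z + w) ≤ sv₁ z + sv₁ w := by
  obtain ⟨e, he, h⟩ := exists_two_mul_ip_eq (z + w)
  rw [← h, ip_add_left]
  linarith [two_mul_ip_le he z, two_mul_ip_le he w]

theorem IsMinimal.sv {e : Coord} (he : IsMinimal e) : sv₁ e = 1 ∧ sv₂ e = 0 :=
  sv_eq le_rfl zero_le_one (by rw [he.2]; norm_num) (by simp [disc, he.1])

theorem sv_neg (z : Coord) : sv₁ (-z) = sv₁ z ∧ sv₂ (-z) = sv₂ z := by
  simpa using sv_smul (-1) z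

/-! ### Karamata-type inequalities -/

section Convex

variable {f : ℝ → ℝ}

theorem add_lt_add_of_strictConvexOn (hf : StrictConvexOn ℝ (Ici 0) f) {x y c d : ℝ}
    (hd : 0 ≤ d) (hx : x < c) (hy : y < c) (h : x + y = c + d) : f x + f y < f c + f d := by
  have hdc : d < c := by linarith
  have hcd : 0 < c - d := sub_pos.2 hdc
  have ha : 0 < (x - d) / (c - d) := div_pos (by linarith) hcd
  have hb : 0 < (y - d) / (c - d) := div_pos (by linarith) hcd
  have hab : (x - d) / (c - d) + (y - d) / (c - d) = 1 := by
    rw [← add_div, div_eq_one_iff_eq hcd.ne']; linarith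
  have hc : c ∈ Ici (0 : ℝ) := by simp only [mem_Ici]; linarith
  have hd' : d ∈ Ici (0 : ℝ) := hd
  have h1 := hf.2 hc hd' hdc.ne' ha hb hab
  have h2 := hf.2 hd' hc hdc.ne ha hb hab
  have e1 : ((x - d) / (c - d)) • c + ((y - d) / (c - d)) • d = x := by
    simp only [smul_eq_mul]; field_simp; linear_combination d * h
  have e2 : ((x - d) / (c - d)) • d + ((y - d) / (c - d)) • c = y := by
    simp only [smul_eq_mul]; field_simp; linear_combination d * h
  rw [e1] at h1
  rw [e2] at h2
  simp only [smul_eq_mul] at h1 h2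
  have e3 := congrArg (fun s => s * (f c + f d)) hab
  simp only [one_mul] at e3
  linarith

/-- Karamata's inequality for pairs. -/
theorem add_le_add_of_strictConvexOn (hf : StrictConvexOn ℝ (Ici 0) f) {x y c d : ℝ}
    (hd : 0 ≤ d) (hx : x ≤ c) (hy : y ≤ c) (h : x + y = c + d) : f x + f y ≤ f c + f d := by
  rcases hx.eq_or_lt with rfl | hx
  · rw [show y = d by linarith]
  rcases hy.eq_or_lt with rfl | hy
  · rw [show x = d by linarith, add_comm]
  exact (add_lt_add_of_strictConvexOn hf hd hx hy h).le

theorem superadd_of_strictConvexOn (hf : StrictConvexOn ℝ (Ici 0) f) (h0 : f 0 = 0) {x y : ℝ}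
    (hx : 0 ≤ x) (hy : 0 ≤ y) : f x + f y ≤ f (x + y) := by
  have := add_le_add_of_strictConvexOn hf (x := x) (y := y) (c := x + y) le_rfl (by linarith)
    (by linarith) (by ring)
  linarith

theorem superadd_lt_of_strictConvexOn (hf : StrictConvexOn ℝ (Ici 0) f) (h0 : f 0 = 0) {x y : ℝ}
    (hx : 0 < x) (hy : 0 < y) : f x + f y < f (x + y) := by
  have := add_lt_add_of_strictConvexOn hf (x := x) (y := y) (c := x + y) le_rfl (by linarith)
    (by linarith) (by ring)
  linarith

theorem mul_lt_mul_of_strictConvexOn (hf : StrictConvexOn ℝ (Ici 0) f) (h0 : f 0 = 0) {x y : ℝ}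
    (hx : 0 < x) (hxy : x < y) : y * f x < x * f y := by
  have hy : 0 < y := hx.trans hxy
  have h := hf.2 (mem_Ici.2 hy.le) (mem_Ici.2 le_rfl) hy.ne' (div_pos hx hy)
    (div_pos (sub_pos.2 hxy) hy) (by rw [← add_div, add_sub_cancel, div_self hy.ne'])
  simp only [smul_eq_mul, mul_zero, add_zero, h0, div_mul_cancel₀ x hy.ne'] at h
  have := mul_lt_mul_of_pos_left h hy
  rwa [← mul_assoc, mul_div_cancel₀ x hy.ne'] at this

theorem mul_le_mul_of_strictConvexOn (hf : StrictConvexOn ℝ (Ici 0) f) (h0 : f 0 = 0) {x y : ℝ}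
    (hx : 0 ≤ x) (hxy : x ≤ y) : y * f x ≤ x * f y := by
  rcases hx.eq_or_lt with rfl | hx
  · simp [h0]
  rcases hxy.eq_or_lt with rfl | hxy
  · rfl
  exact (mul_lt_mul_of_strictConvexOn hf h0 hx hxy).le

/-- If a₁ or b₁ reaches c₂, superadditivity merges the other three numbers and Karamata compares the
resulting pairs. Otherwise all four lie below c₂, and the monotonicity of f(x)/x suffices.
Strictness comes from a₂ > 0 or from a₁ < c₂. -/
theorem four_lt_of_strictConvexOn (hf : StrictConvexOn ℝ (Ici 0) f) (h0 : f 0 = 0)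
    {a₁ a₂ b₁ b₂ c₁ c₂ : ℝ} (ha₂ : 0 < a₂) (ha : a₂ ≤ a₁) (hb₂ : 0 ≤ b₂) (hb : b₂ ≤ b₁)
    (hb₁ : 0 < b₁) (hc₂ : 0 ≤ c₂) (hc : c₂ ≤ c₁) (hac : a₁ ≤ c₁) (hbc : b₁ ≤ c₁)
    (h : a₁ + a₂ + (b₁ + b₂) = c₁ + c₂) : f a₁ + f a₂ + (f b₁ + f b₂) < f c₁ + f c₂ := by
  rcases le_or_gt c₂ a₁ with h1 | h1
  · have k1 := superadd_lt_of_strictConvexOn hf h0 ha₂ hb₁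
    have k2 := superadd_of_strictConvexOn hf h0 (x := a₂ + b₁) (y := b₂) (by linarith) hb₂
    have k3 := add_le_add_of_strictConvexOn hf (x := a₁) (y := a₂ + b₁ + b₂) hc₂ hac (by linarith)
      (by linarith)
    linarith
  rcases le_or_gt c₂ b₁ with h2 | h2
  · have k1 := superadd_lt_of_strictConvexOn hf h0 (ha₂.trans_le ha) ha₂
    have k2 := superadd_of_strictConvexOn hf h0 (x := a₁ + a₂) (y := b₂) (by linarith) hb₂
    have k3 := add_le_add_of_strictConvexOn hf (x := b₁) (y := a₁ + a₂ + b₂) hc₂ hbc (by linarith)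
      (by linarith)
    linarith
  · have k1 := mul_lt_mul_of_strictConvexOn hf h0 (ha₂.trans_le ha) h1
    have k2 := mul_le_mul_of_strictConvexOn hf h0 ha₂.le (ha.trans h1.le)
    have k3 := mul_le_mul_of_strictConvexOn hf h0 hb₁.le h2.le
    have k4 := mul_le_mul_of_strictConvexOn hf h0 hb₂ (hb.trans h2.le)
    have k5 := mul_le_mul_of_strictConvexOn hf h0 hc₂ hc
    have e := congrArg (fun s => s * f c₂) h
    refine lt_of_mul_lt_mul_left (a := c₂) ?_ hc₂
    linarith

theorem midpoint_le_of_strictConvexOn (hf : StrictConvexOn ℝ (Ici 0) f) {x y : ℝ}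
    (hx : 0 ≤ x) (hy : 0 ≤ y) : 2 * f ((x + y) / 2) ≤ f x + f y := by
  have h := hf.convexOn.2 (mem_Ici.2 hx) (mem_Ici.2 hy) (show (0 : ℝ) ≤ 1 / 2 by norm_num)
    (show (0 : ℝ) ≤ 1 / 2 by norm_num) (by norm_num)
  simp only [smul_eq_mul] at h
  rw [show (x + y) / 2 = 1 / 2 * x + 1 / 2 * y by ring]
  linarith

theorem eq_of_midpoint_of_strictConvexOn (hf : StrictConvexOn ℝ (Ici 0) f) {x y : ℝ}
    (hx : 0 ≤ x) (hy : 0 ≤ y) (h : f x + f y ≤ 2 * f ((x + y) / 2)) : x = y := by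
  by_contra hne
  have h := hf.2 (mem_Ici.2 hx) (mem_Ici.2 hy) hne (show (0 : ℝ) < 1 / 2 by norm_num)
    (show (0 : ℝ) < 1 / 2 by norm_num) (by norm_num)
  simp only [smul_eq_mul] at h
  rw [show 1 / 2 * x + 1 / 2 * y = (x + y) / 2 by ring] at h
  linarith

/-- Weak majorization for pairs, with the case of equality. -/
theorem rpow_weak_majorization {p : ℝ} (hp : 1 < p) {x y c d : ℝ} (hx : 0 ≤ x) (hy : 0 ≤ y)
    (hd : 0 ≤ d) (hxc : x ≤ c) (hyc : y ≤ c) (h : x + y ≤ c + d) :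
    x ^ p + y ^ p ≤ c ^ p + d ^ p ∧
      (x ^ p + y ^ p = c ^ p + d ^ p → x ^ 2 + y ^ 2 = c ^ 2 + d ^ 2) := by
  have hf := strictConvexOn_rpow hp
  have hp0 : (0 : ℝ) < p := by linarith
  have h0 : (0 : ℝ) ^ p = 0 := Real.zero_rpow hp0.ne'
  rcases h.eq_or_lt with h | h
  · rcases hxc.eq_or_lt with rfl | hxc
    · rw [show y = d by linarith]; simp
    rcases hyc.eq_or_lt with rfl | hyc
    · rw [show x = d by linarith]; simp [add_comm]
    have := add_lt_add_of_strictConvexOn hf hd hxc hyc h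
    exact ⟨this.le, fun h' => absurd h' this.ne⟩
  · have key : x ^ p + y ^ p < c ^ p + d ^ p := by
      -- If the sum reaches c, lowering d to x + y - c reduces to equal sums; otherwise
      -- superadditivity alone bounds the left side by (x + y)^p < c^p.
      rcases le_or_gt c (x + y) with h1 | h1
      · have k1 := add_le_add_of_strictConvexOn hf (d := x + y - c) (by linarith) hxc hyc (by ring)
        have k2 := Real.rpow_lt_rpow (x := x + y - c) (y := d) (by linarith) (by linarith) hp0
        linarith
      · have k1 := superadd_of_strictConvexOn hf h0 hx hy
        have k2 := Real.rpow_lt_rpow (by linarith) h1 hp0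
        have k3 := Real.rpow_nonneg hd p
        linarith
    exact ⟨key.le, fun h' => absurd h' key.ne⟩

end Convex

/-! ### Strict convexity and the Clarkson-McCarthy inequality -/

/-- The Schatten norm is strictly convex. -/
theorem eq_neg_of_schattenPow_sub {p : ℝ} (hp : 1 < p) {a b : Coord} (ha : schattenPow p a = 1)
    (hb : schattenPow p b = 1) (h : schattenPow p (a - b) = 2 ^ p) : b = -a := by
  have hf := strictConvexOn_rpow hp
  -- The singular values of the midpoint m of a and -b are weakly majorized by the averages of those
  -- of a and b. As m has norm one, every inequality is an equality, so a, b and m have the same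
  -- energy, and the parallelogram law gives a + b = 0.
  set m : Coord := (1 / 2 : ℂ) • (a - b) with hm
  have hsm := sv_smul (1 / 2) (a - b)
  rw [← hm] at hsm
  have hN : schattenPow p m = 1 := by
    rw [hm, schattenPow_smul, h, ← Real.mul_rpow (norm_nonneg _) (by norm_num)]
    norm_num
  have hb1 := (sv_neg b).1
  have hb2 := (sv_neg b).2
  have h1 : sv₁ m ≤ (sv₁ a + sv₁ b) / 2 := by
    have := sv₁_add_le a (-b)
    rw [hb1, ← sub_eq_add_neg] at this
    rw [hsm.1]; norm_num; linarith
  have h2 : sv₁ m + sv₂ m ≤ (sv₁ a + sv₁ b) / 2 + (sv₂ a + sv₂ b) / 2 := by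
    have := sv_add_le a (-b)
    rw [hb1, hb2, ← sub_eq_add_neg] at this
    rw [hsm.1, hsm.2]; norm_num; linarith
  obtain ⟨k1, k2⟩ := rpow_weak_majorization hp (sv₁_nonneg m) (sv₂_nonneg m)
    (by linarith [sv₂_nonneg a, sv₂_nonneg b]) h1 ((sv₂_le_sv₁ m).trans h1) h2
  have c1 := midpoint_le_of_strictConvexOn hf (sv₁_nonneg a) (sv₁_nonneg b)
  have c2 := midpoint_le_of_strictConvexOn hf (sv₂_nonneg a) (sv₂_nonneg b)
  simp only [schattenPow] at ha hb hN
  have e1 := eq_of_midpoint_of_strictConvexOn hf (sv₁_nonneg a) (sv₁_nonneg b) (by linarith)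
  have e2 := eq_of_midpoint_of_strictConvexOn hf (sv₂_nonneg a) (sv₂_nonneg b) (by linarith)
  have e3 := k2 (by linarith)
  rw [← e1, ← e2] at e3
  have t1 := sv_sq_add m
  have t2 := sv_sq_add a
  have t3 := sv_sq_add b
  rw [← e1, ← e2] at t3
  have t4 : energy m = 1 / 4 * energy (a - b) := by
    rw [hm, energy_smul]; norm_num
  have t5 : energy (a + b) = 0 := by
    have q1 := energy_add a b
    have q2 := energy_sub a b
    ring_nf at e3
    linarith
  exact eq_neg_of_add_eq_zero_right (energy_eq_zero t5)

/-- The trace of `f (a⋆ a)`. -/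
noncomputable def traceFun (f : ℝ → ℝ) (z : Coord) : ℝ :=
  f (energy z + width z) + f (energy z - width z)

theorem schattenPow_eq_traceFun (p : ℝ) (z : Coord) :
    schattenPow p z = traceFun (fun x => x ^ (p / 2)) z := by
  have h : ∀ x : ℝ, 0 ≤ x → √x ^ p = x ^ (p / 2) := fun x hx => by
    rw [Real.sqrt_eq_rpow, ← Real.rpow_mul hx]; congr 1; ring
  rw [schattenPow, sv₁, sv₂, traceFun, h _ (add_nonneg (energy_nonneg z) (width_nonneg z)),
    h _ (sub_nonneg.2 (width_le_energy z))]

/-- The traceless part of the parallelogram identity |a + b|² + |a - b|² = 2(|a|² + |b|²). -/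
theorem moment_add_add_moment_sub (a b : Coord) :
    moment (a + b) + moment (a - b) = (2 : ℝ) • (moment a + moment b) := by
  ext i
  fin_cases i <;> simp [moment] <;> ring

/-- The Clarkson-McCarthy inequality is strict if one of the operators is invertible. -/
theorem clarkson_lt {f : ℝ → ℝ} (hf : StrictConvexOn ℝ (Ici 0) f) (h0 : f 0 = 0) {a b : Coord}
    (ha : width a < energy a) (hb : 0 < energy b) :
    2 * (traceFun f a + traceFun f b) < traceFun f (a + b) + traceFun f (a - b) := by
  have hm := congrArg norm (moment_add_add_moment_sub a b)
  have n1 := norm_add_le (moment (a + b)) (moment (a - b))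
  have n2 := norm_sub_norm_le (moment a) (-moment b)
  have n3 := norm_sub_norm_le (moment b) (-moment a)
  have n4 := norm_add_le (moment a) (moment b)
  rw [sub_neg_eq_add, norm_neg] at n2 n3
  rw [add_comm (moment b)] at n3
  rw [norm_smul, Real.norm_ofNat] at hm
  rw [hm] at n1
  have eA := energy_add a b
  have eS := energy_sub a b
  simp only [norm_moment] at n1 n2 n3 n4
  have wa := width_nonneg a
  have wb := width_nonneg b
  have wa' := width_le_energy a
  have wb' := width_le_energy b
  have wA := width_le_energy (a + b)
  have wS := width_le_energy (a - b)
  have wA' := width_nonneg (a + b)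
  have wS' := width_nonneg (a - b)
  have hv := norm_nonneg (moment a + moment b)
  set v := ‖moment a + moment b‖
  -- Three comparisons are chained: the eigenvalues of |a ± b|² are averaged (`k1`, `k2`); the
  -- averages majorize the eigenvalues of |a|² + |b|² (`k3`); and these dominate the four
  -- eigenvalues of |a|² and |b|² together (`k4`), where strictness enters.
  have k1 := midpoint_le_of_strictConvexOn hf (x := energy (a + b) + width (a + b))
    (y := energy (a - b) + width (a - b)) (by linarith) (by linarith)
  have k2 := midpoint_le_of_strictConvexOn hf (x := energy (a + b) - width (a + b))
    (y := energy (a - b) - width (a - b)) (by linarith) (by linarith)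
  have k3 := add_le_add_of_strictConvexOn hf
    (x := energy a + energy b + v) (y := energy a + energy b - v)
    (c := (energy (a + b) + width (a + b) + (energy (a - b) + width (a - b))) / 2)
    (d := (energy (a + b) - width (a + b) + (energy (a - b) - width (a - b))) / 2)
    (by linarith) (by linarith) (by linarith) (by linarith)
  have k4 := four_lt_of_strictConvexOn hf h0 (a₁ := energy a + width a) (a₂ := energy a - width a)
    (b₁ := energy b + width b) (b₂ := energy b - width b)
    (c₁ := energy a + energy b + v) (c₂ := energy a + energy b - v)
    (by linarith) (by linarith) (by linarith) (by linarith) (by linarith) (by linarith)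
    (by linarith) (by linarith) (by linarith) (by ring)
  simp only [traceFun]
  linarith

/-- With r = p/2, the sign of the function absorbs the reversal of inequalities between p > 2 and p
< 2; the convexity arguments need no monotonicity of f. -/
theorem strictConvexOn_rpow_or_neg {r : ℝ} (hr0 : 0 < r) (hr1 : r ≠ 1) :
    StrictConvexOn ℝ (Ici 0) (fun x : ℝ => x ^ r) ∨
      StrictConvexOn ℝ (Ici 0) (fun x : ℝ => -x ^ r) := by
  rcases lt_or_gt_of_ne hr1 with h | h
  · exact Or.inr (Real.strictConcaveOn_rpow hr0 h).neg
  · exact Or.inl (strictConvexOn_rpow h)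

theorem disc_eq_zero_of_clarkson {p : ℝ} (hp : 0 < p) (hp2 : p ≠ 2) {a b : Coord}
    (ha : schattenPow p a = 1) (hb : schattenPow p b = 1)
    (h : schattenPow p (a + b) + schattenPow p (a - b) = 4) : disc a = 0 := by
  by_contra hd
  have hw : width a < energy a := by
    have := width_sq a
    have hd' : 0 < disc a := (disc_nonneg a).lt_of_ne' hd
    exact lt_of_pow_lt_pow_left₀ 2 (energy_nonneg a) (by nlinarith)
  have hb0 := energy_pos_of_schattenPow hp.ne' hb
  have hr : p / 2 ≠ 0 := by positivity
  simp only [schattenPow_eq_traceFun] at ha hb h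
  rcases strictConvexOn_rpow_or_neg (half_pos hp) (by
    intro h; apply hp2; linarith) with hf | hf
  · have := clarkson_lt hf (Real.zero_rpow hr) hw hb0
    linarith
  · have := clarkson_lt hf (by simp [Real.zero_rpow hr]) hw hb0
    simp only [traceFun] at this ha hb h
    linarith

theorem IsMinimal.schattenPow_add_sub_bar {e : Coord} (he : IsMinimal e) (p : ℝ) :
    SpinFactor.schattenPow p (e + SpinFactor.bar e) = 2 ∧
      SpinFactor.schattenPow p (e - SpinFactor.bar e) = 2 := by
  have h1 := schattenPow_smul_add_smul_bar he p 1 1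
  have h2 := schattenPow_smul_add_smul_bar he p 1 (-1)
  simp only [one_smul, neg_smul, norm_neg, norm_one, Real.one_rpow, ← sub_eq_add_neg] at h1 h2
  constructor <;> linarith

/-! ### Recovering inner product and determinant from two distances -/

/-- The `p`-th power of the Schatten norm as a function of the energy and the determinant. -/
noncomputable def schattenVal (p t d : ℝ) : ℝ :=
  √(t + √(t ^ 2 - d ^ 2)) ^ p + √(t - √(t ^ 2 - d ^ 2)) ^ p

theorem schattenPow_eq_schattenVal (p : ℝ) (z : Coord) :
    schattenPow p z = schattenVal p (energy z) (disc z) := rfl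

/-- At constant product the sum grows with the larger factor: expand (x'^p - x^p)(x'^p - y^p) > 0
and divide by x'^p. -/
theorem rpow_add_rpow_lt {p x y x' y' : ℝ} (hp : 0 < p) (hy : 0 ≤ y) (hyx : y ≤ x) (hx : x < x')
    (hy' : 0 ≤ y') (h : x * y = x' * y') : x ^ p + y ^ p < x' ^ p + y' ^ p := by
  have hx0 : 0 ≤ x := hy.trans hyx
  have h1 : x ^ p < x' ^ p := Real.rpow_lt_rpow hx0 hx hp
  have h2 : y ^ p ≤ x ^ p := Real.rpow_le_rpow hy hyx hp.le
  have h3 : x ^ p * y ^ p = x' ^ p * y' ^ p := by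
    rw [← Real.mul_rpow hx0 hy, h, Real.mul_rpow (hx0.trans hx.le) hy']
  have h4 : 0 ≤ x ^ p := Real.rpow_nonneg hx0 p
  nlinarith [mul_pos (sub_pos.2 h1) (sub_pos.2 (h2.trans_lt h1))]

theorem schattenVal_lt_of_lt {p : ℝ} (hp : 0 < p) {t t' d : ℝ} (hd : 0 ≤ d) (hdt : d ≤ t)
    (h : t < t') : schattenVal p t d < schattenVal p t' d := by
  have w0 : ∀ s : ℝ, 0 ≤ √(s ^ 2 - d ^ 2) := fun s => Real.sqrt_nonneg _
  have w1 : ∀ s : ℝ, d ≤ s → √(s ^ 2 - d ^ 2) ^ 2 = s ^ 2 - d ^ 2 := fun s hs =>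
    Real.sq_sqrt (by nlinarith)
  have w2 : ∀ s : ℝ, d ≤ s → √(s ^ 2 - d ^ 2) ≤ s := fun s hs =>
    abs_le_of_sq_le_sq' (by rw [w1 s hs]; nlinarith) (hd.trans hs) |>.2
  have w3 : √(t ^ 2 - d ^ 2) ≤ √(t' ^ 2 - d ^ 2) := Real.sqrt_le_sqrt (by nlinarith)
  have hprod : ∀ s : ℝ, d ≤ s →
      √(s + √(s ^ 2 - d ^ 2)) * √(s - √(s ^ 2 - d ^ 2)) = d := fun s hs => by
    rw [← Real.sqrt_mul (by linarith [w0 s]), ← Real.sqrt_sq hd]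
    congr 1
    rw [Real.sqrt_sq hd]
    linear_combination -w1 s hs
  refine rpow_add_rpow_lt hp (Real.sqrt_nonneg _) (Real.sqrt_le_sqrt (by linarith [w0 t]))
    (Real.sqrt_lt_sqrt (by linarith [w0 t]) (by linarith)) (Real.sqrt_nonneg _) ?_
  rw [hprod t hdt, hprod t' (hdt.trans h.le)]

theorem schattenVal_eq {p t d : ℝ} (hd : 0 ≤ d) (hdt : d ≤ t) :
    schattenVal p t d =
      (t + √(t ^ 2 - d ^ 2)) ^ (p / 2) + (t - √(t ^ 2 - d ^ 2)) ^ (p / 2) := by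
  have h : ∀ x : ℝ, 0 ≤ x → √x ^ p = x ^ (p / 2) := fun x hx => by
    rw [Real.sqrt_eq_rpow, ← Real.rpow_mul hx]; congr 1; ring
  have w0 : 0 ≤ √(t ^ 2 - d ^ 2) := Real.sqrt_nonneg _
  have w2 : √(t ^ 2 - d ^ 2) ≤ t :=
    Real.sqrt_le_iff.2 ⟨hd.trans hdt, by nlinarith⟩
  rw [schattenVal, h _ (by linarith), h _ (by linarith)]

/-- At constant energy, the Schatten norm is a strictly monotone function of the determinant. -/
theorem schattenVal_mono_or_anti {p : ℝ} (hp : 0 < p) (hp2 : p ≠ 2) :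
    (∀ t d d' : ℝ, 0 ≤ d → d < d' → d' ≤ t → schattenVal p t d < schattenVal p t d') ∨
      (∀ t d d' : ℝ, 0 ≤ d → d < d' → d' ≤ t → schattenVal p t d' < schattenVal p t d) := by
  have key : ∀ f : ℝ → ℝ, StrictConvexOn ℝ (Ici 0) f → ∀ t d d' : ℝ, 0 ≤ d → d < d' → d' ≤ t →
      f (t + √(t ^ 2 - d' ^ 2)) + f (t - √(t ^ 2 - d' ^ 2)) <
        f (t + √(t ^ 2 - d ^ 2)) + f (t - √(t ^ 2 - d ^ 2)) := by
    intro f hf t d d' hd hdd hdt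
    have w : √(t ^ 2 - d' ^ 2) < √(t ^ 2 - d ^ 2) :=
      Real.sqrt_lt_sqrt (by nlinarith) (by nlinarith)
    have w0 : 0 ≤ √(t ^ 2 - d' ^ 2) := Real.sqrt_nonneg _
    have w2 : √(t ^ 2 - d ^ 2) ≤ t := Real.sqrt_le_iff.2 ⟨by linarith, by nlinarith⟩
    exact add_lt_add_of_strictConvexOn hf (by linarith) (by linarith) (by linarith) (by ring)
  rcases strictConvexOn_rpow_or_neg (half_pos hp) (by
    intro h; apply hp2; linarith) with hf | hf
  · right
    intro t d d' hd hdd hdt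
    rw [schattenVal_eq hd (hdd.le.trans hdt), schattenVal_eq (hd.trans hdd.le) hdt]
    exact key _ hf t d d' hd hdd hdt
  · left
    intro t d d' hd hdd hdt
    rw [schattenVal_eq hd (hdd.le.trans hdt), schattenVal_eq (hd.trans hdd.le) hdt]
    have := key _ hf t d d' hd hdd hdt
    linarith

/-- Raising R lowers the energy in one equation and raises it in the other. Compensation would
require d to move in opposite directions, since monotonicity in d has the same direction in both. -/
theorem not_lt_of_schattenVal {p : ℝ} (hp : 0 < p) (hp2 : p ≠ 2) {R R' d d' : ℝ} (hd : 0 ≤ d)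
    (hd' : 0 ≤ d') (h1 : d ≤ 1 - 2 * R) (h2 : d ≤ 1 + 2 * R) (h1' : d' ≤ 1 - 2 * R')
    (h2' : d' ≤ 1 + 2 * R')
    (e1 : schattenVal p (1 - 2 * R) d = schattenVal p (1 - 2 * R') d')
    (e2 : schattenVal p (1 + 2 * R) d = schattenVal p (1 + 2 * R') d') : ¬ R < R' := by
  intro hR
  have m1 := schattenVal_lt_of_lt hp hd h2 (show 1 + 2 * R < 1 + 2 * R' by linarith)
  have m2 := schattenVal_lt_of_lt hp hd' h1' (show 1 - 2 * R' < 1 - 2 * R by linarith)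
  rcases lt_trichotomy d d' with h | rfl | h
  · rcases schattenVal_mono_or_anti hp hp2 with H | H
    · have := H (1 - 2 * R) d d' hd h (by linarith)
      have k := H (1 + 2 * R') d d' hd h h2'
      linarith
    · have := H (1 + 2 * R') d d' hd h h2'
      have k := H (1 - 2 * R) d d' hd h (by linarith)
      linarith
  · linarith
  · rcases schattenVal_mono_or_anti hp hp2 with H | H
    · have := H (1 - 2 * R) d' d hd' h h1
      linarith
    · have := H (1 + 2 * R') d' d hd' h (by linarith)
      linarith

theorem eq_of_schattenVal {p : ℝ} (hp : 0 < p) (hp2 : p ≠ 2) {R R' d d' : ℝ} (hd : 0 ≤ d)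
    (hd' : 0 ≤ d') (h1 : d ≤ 1 - 2 * R) (h2 : d ≤ 1 + 2 * R) (h1' : d' ≤ 1 - 2 * R')
    (h2' : d' ≤ 1 + 2 * R')
    (e1 : schattenVal p (1 - 2 * R) d = schattenVal p (1 - 2 * R') d')
    (e2 : schattenVal p (1 + 2 * R) d = schattenVal p (1 + 2 * R') d') : R = R' ∧ d = d' := by
  have hR : R = R' := le_antisymm
    (not_lt.1 (not_lt_of_schattenVal hp hp2 hd' hd h1' h2' h1 h2 e1.symm e2.symm))
    (not_lt.1 (not_lt_of_schattenVal hp hp2 hd hd' h1 h2 h1' h2' e1 e2))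
  subst hR
  refine ⟨rfl, ?_⟩
  by_contra hne
  rcases lt_or_gt_of_ne hne with h | h
  · rcases schattenVal_mono_or_anti hp hp2 with H | H
    · exact (H _ d d' hd h h1').ne e1
    · exact (H _ d d' hd h h1').ne e1.symm
  · rcases schattenVal_mono_or_anti hp hp2 with H | H
    · exact (H _ d' d hd' h h1).ne e1.symm
    · exact (H _ d' d hd' h h1).ne e1

theorem IsMinimal.energy_disc {e f : Coord} (he : IsMinimal e) (hf : IsMinimal f) :
    energy (e - f) = 1 - 2 * ip e f ∧ energy (e + f) = 1 + 2 * ip e f ∧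
      disc (e - f) = 2 * ‖pair e f‖ ∧ disc (e + f) = 2 * ‖pair e f‖ := by
  refine ⟨by rw [energy_sub, he.2, hf.2]; ring, by rw [energy_add, he.2, hf.2]; ring, ?_, ?_⟩
  · have h : pair (e + (-1 : ℂ) • f) (e + (-1 : ℂ) • f) = (-2) * pair e f := by
      simp only [pair_add_left, pair_add_right, pair_smul_left, pair_smul_right, he.1, hf.1,
        pair_comm f e]
      ring
    rw [disc, sub_eq_add_neg, ← neg_one_smul ℂ f, h, norm_mul]; simp
  · have h : pair (e + f) (e + f) = 2 * pair e f := by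
      simp only [pair_add_left, pair_add_right, he.1, hf.1, pair_comm f e]
      ring
    rw [disc, h, norm_mul]; simp

/-- The distances to `e` and `-e` determine the real inner product and the determinant of minimal
partial isometries. -/
theorem IsMinimal.ip_eq_and_norm_pair_eq {p : ℝ} (hp : 0 < p) (hp2 : p ≠ 2) {e f e' f' : Coord}
    (he : IsMinimal e) (hf : IsMinimal f) (he' : IsMinimal e') (hf' : IsMinimal f')
    (h1 : SpinFactor.schattenPow p (e - f) = SpinFactor.schattenPow p (e' - f'))
    (h2 : SpinFactor.schattenPow p (e + f) = SpinFactor.schattenPow p (e' + f')) :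
    ip e f = ip e' f' ∧ ‖pair e f‖ = ‖pair e' f'‖ := by
  obtain ⟨a1, a2, a3, a4⟩ := he.energy_disc hf
  obtain ⟨b1, b2, b3, b4⟩ := he'.energy_disc hf'
  have c1 := disc_le_energy (e - f)
  have c2 := disc_le_energy (e + f)
  have d1 := disc_le_energy (e' - f')
  have d2 := disc_le_energy (e' + f')
  rw [schattenPow_eq_schattenVal, schattenPow_eq_schattenVal, a1, a3, b1, b3] at h1
  rw [schattenPow_eq_schattenVal, schattenPow_eq_schattenVal, a2, a4, b2, b4] at h2
  rw [a1, a3] at c1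
  rw [a2, a4] at c2
  rw [b1, b3] at d1
  rw [b2, b4] at d2
  obtain ⟨k1, k2⟩ := eq_of_schattenVal hp hp2 (by positivity) (by positivity) c1 c2 d1 d2 h1 h2
  exact ⟨k1, by linarith⟩

/-! ### Weyl and Mirsky inequalities; distances to minimal partial isometries -/

theorem moment_add_smul (w e : Coord) (s : ℝ) :
    moment (w + s • e) =
      moment w + s • (moment (w + e) - moment w - moment e) + s ^ 2 • moment e := by
  ext i
  fin_cases i <;> simp [moment] <;> ring

theorem eq_zero_of_forall_nonneg {a c : ℝ} (h : ∀ s : ℝ, 0 ≤ a + s * c) : c = 0 := by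
  by_contra hc
  have := h (-(a + 1) / c)
  rw [div_mul_cancel₀ _ hc] at this
  linarith

/-- Weyl's inequality for perturbations of rank one. -/
theorem sv₂_le_sv₁_sub {e : Coord} (he : IsMinimal e) (y : Coord) : sv₂ y ≤ sv₁ (y - e) := by
  have hme : ‖moment e‖ ^ 2 = 1 / 4 := by
    rw [norm_moment_sq, he.2, disc, he.1]; norm_num
  have hme1 : ‖moment e‖ = 1 / 2 := by
    refine (sq_eq_sq₀ (norm_nonneg _) (by norm_num)).1 (by rw [hme]; norm_num)
  have hb : ∀ z, |2 * inner ℝ (moment e) (moment z)| ≤ width z := fun z => by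
    have := abs_real_inner_le_norm (moment e) (moment z)
    rw [hme1, norm_moment] at this
    rw [abs_mul, abs_two]; linarith
  set w := y - e with hw
  -- The left side is ‖zη‖² at z = w + s e, for a unit vector η in the kernel of e, so it cannot
  -- depend on s. In coordinates the s² terms cancel, and an affine function that is nonnegative on
  -- ℝ is constant.
  have hlin : ∀ s : ℝ, energy (w + s • e) - 2 * inner ℝ (moment e) (moment (w + s • e)) =
      energy w - 2 * inner ℝ (moment e) (moment w) + s * (2 * ip w e -
        2 * inner ℝ (moment e) (moment (w + e) - moment w - moment e)) := fun s => by
    rw [moment_add_smul, energy_add, inner_add_right, inner_add_right, real_inner_smul_right,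
      real_inner_smul_right, real_inner_self_eq_norm_sq, hme, ip_smul_right]
    have : energy (s • e) = s ^ 2 * (1 / 2) := by
      rw [energy, ip_smul_left, ip_smul_right, ← energy, he.2]; ring
    rw [this]; ring
  have hc := eq_zero_of_forall_nonneg fun s => by
    rw [← hlin s]
    have := (abs_le.1 (hb (w + s • e))).2
    linarith [width_le_energy (w + s • e)]
  have h1 := hlin 1
  rw [hc, one_smul, hw, sub_add_cancel, ← hw] at h1
  have h2 := (abs_le.1 (hb y)).2
  have h3 := (abs_le.1 (hb w)).1
  exact Real.sqrt_le_sqrt (by linarith)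

theorem sv₁_le_one {p : ℝ} (hp : 0 < p) {z : Coord} (hz : schattenPow p z = 1) : sv₁ z ≤ 1 := by
  by_contra! h
  have h1 := Real.one_lt_rpow h hp
  have h2 := Real.rpow_nonneg (sv₂_nonneg z) p
  rw [schattenPow] at hz
  linarith

/-- Mirsky's inequality for the distance to a minimal partial isometry, with the case of equality. -/
theorem mirsky {p : ℝ} (hp : 1 < p) {e y : Coord} (he : IsMinimal e) (hy : schattenPow p y = 1) :
    (1 - sv₁ y) ^ p + sv₂ y ^ p ≤ schattenPow p (y - e) ∧
      ((1 - sv₁ y) ^ p + sv₂ y ^ p = schattenPow p (y - e) → 2 * ip y e = sv₁ y) := by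
  have hs := sv_neg (y - e)
  rw [neg_sub] at hs
  have h1 : 1 - sv₁ y ≤ sv₁ (y - e) := by
    have := sv₁_add_le y (e - y)
    rw [add_sub_cancel, he.sv.1, hs.1] at this
    linarith
  have h2 : 1 - sv₁ y + sv₂ y ≤ sv₁ (y - e) + sv₂ (y - e) := by
    have := sv_gap_add_le y (e - y)
    rw [add_sub_cancel, he.sv.1, he.sv.2, hs.1, hs.2] at this
    linarith
  obtain ⟨k1, k2⟩ := rpow_weak_majorization hp (by linarith [sv₁_le_one (by linarith) hy])
    (sv₂_nonneg y) (sv₂_nonneg (y - e)) h1 (sv₂_le_sv₁_sub he y) h2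
  refine ⟨k1, fun h => ?_⟩
  have k3 := k2 h
  have k4 := sv_sq_add (y - e)
  have k5 := sv_sq_add y
  rw [energy_sub, he.2] at k4
  nlinarith

/-- Equality in the reverse triangle inequality: s μ points in the direction of ν. -/
theorem eq_of_norm_sub_eq {μ ν : ℂ} (hμ : ‖μ‖ = 1) (hν : ‖ν‖ = 1) {s : ℝ} (hs : 0 < s)
    (h : ‖s * μ - ν‖ = 1 - s) : μ = ν := by
  have h1 := congrArg (fun x => x ^ 2) h
  have h2 := congrArg (fun x => x ^ 2) hμ
  have h3 := congrArg (fun x => x ^ 2) hν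
  simp only [Complex.sq_norm, Complex.normSq_apply, Complex.sub_re, Complex.sub_im,
    Complex.re_ofReal_mul, Complex.im_ofReal_mul] at h1 h2 h3
  have h4 : s * (μ.re * ν.re + μ.im * ν.im - 1) = 0 := by
    linear_combination (-1 / 2) * h1 + s ^ 2 / 2 * h2 + 1 / 2 * h3
  have h5 := (mul_eq_zero.1 h4).resolve_left hs.ne'
  rw [← sub_eq_zero, ← norm_eq_zero, ← sq_eq_zero_iff, Complex.sq_norm, Complex.normSq_apply,
    Complex.sub_re, Complex.sub_im]
  linear_combination h2 + h3 - 2 * h5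

theorem exists_svd (z : Coord) : ∃ e : Coord, IsMinimal e ∧ ∃ μ : ℂ, ‖μ‖ = 1 ∧
    z = (sv₁ z : ℂ) • e + (sv₂ z * μ) • bar e := by
  obtain ⟨e, he, h⟩ := exists_two_mul_ip_eq z
  exact ⟨e, he, eq_of_two_mul_ip_eq he h⟩

theorem schattenPow_sub_svd {p : ℝ} (hp : 0 < p) {e x : Coord} (he : IsMinimal e) {μ : ℂ}
    (hμ : ‖μ‖ = 1) (hx1 : schattenPow p x = 1)
    (hx : x = (sv₁ x : ℂ) • e + (sv₂ x * μ) • bar e) :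
    schattenPow p (x - e) = (1 - sv₁ x) ^ p + sv₂ x ^ p := by
  have e1 : x - e = ((sv₁ x : ℂ) - 1) • e + (sv₂ x * μ) • bar e := by
    nth_rewrite 1 [hx]; rw [sub_smul, one_smul]; abel
  rw [e1, schattenPow_smul_add_smul_bar he, norm_mul, hμ, mul_one, Complex.norm_real,
    Real.norm_of_nonneg (sv₂_nonneg x), norm_sub_rev, ← Complex.ofReal_one, ← Complex.ofReal_sub,
    Complex.norm_real, Real.norm_of_nonneg (sub_nonneg.2 (sv₁_le_one hp hx1))]

/-- On the sphere the Mirsky bound is (1 - σ₁)^p + 1 - σ₁^p, strictly decreasing in σ₁. The element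
x attains it at the leading term of its decomposition, and y cannot go below its own bound there. -/
theorem sv₁_le_of_forall {p : ℝ} (hp : 1 < p) {x y : Coord} (hx : schattenPow p x = 1)
    (hy : schattenPow p y = 1)
    (h : ∀ e, IsMinimal e → schattenPow p (x - e) = schattenPow p (y - e)) : sv₁ x ≤ sv₁ y := by
  have hp0 : 0 < p := by linarith
  by_contra! hlt
  obtain ⟨e, he, μ, hμ, hsvd⟩ := exists_svd x
  have h1 := schattenPow_sub_svd hp0 he hμ hx hsvd
  have h2 := (mirsky hp he hy).1
  rw [h e he] at h1
  rw [schattenPow] at hx hy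
  have h3 := Real.rpow_lt_rpow (sv₁_nonneg y) hlt hp0
  have h4 := Real.rpow_lt_rpow (x := 1 - sv₁ x) (y := 1 - sv₁ y)
    (by linarith [sv₁_le_one hp0 hx]) (by linarith) hp0
  linarith

/-- The distances to the minimal partial isometries determine a point of the unit sphere. -/
theorem eq_of_forall_isMinimal {p : ℝ} (hp : 1 < p) {x y : Coord} (hx : schattenPow p x = 1)
    (hy : schattenPow p y = 1)
    (h : ∀ e, IsMinimal e → schattenPow p (x - e) = schattenPow p (y - e)) : x = y := by
  have hp0 : 0 < p := by linarith
  have h1 : sv₁ x = sv₁ y := le_antisymm (sv₁_le_of_forall hp hx hy h)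
    (sv₁_le_of_forall hp hy hx fun e he => (h e he).symm)
  have h2 : sv₂ x = sv₂ y := by
    rw [← Real.rpow_left_inj (sv₂_nonneg x) (sv₂_nonneg y) hp0.ne']
    rw [schattenPow] at hx hy
    rw [h1] at hx
    linarith
  obtain ⟨e, he, μ, hμ, hsvd⟩ := exists_svd x
  have h3 := schattenPow_sub_svd hp0 he hμ hx hsvd
  rw [h e he, h1, h2] at h3
  obtain ⟨ν, hν, hsvd'⟩ := eq_of_two_mul_ip_eq he ((mirsky hp he hy).2 h3.symm)
  rw [h1, h2] at hsvd
  rcases (sv₂_nonneg y).eq_or_lt with h0 | h0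
  · refine hsvd.trans (Eq.trans ?_ hsvd'.symm)
    rw [← h0]; simp
  -- Both decompositions now share e and the singular values; the distance to the second term of x
  -- detects the remaining phase.
  have h4 := h _ (he.bar.smul hμ)
  have ex : x - μ • bar e = (sv₁ y : ℂ) • e + (sv₂ y * μ - μ) • bar e := by
    nth_rewrite 1 [hsvd]; rw [sub_smul, add_sub_assoc]
  have ey : y - μ • bar e = (sv₁ y : ℂ) • e + (sv₂ y * ν - μ) • bar e := by
    nth_rewrite 1 [hsvd']; rw [sub_smul, add_sub_assoc]
  have hle : sv₂ y ≤ 1 := (sv₂_le_sv₁ y).trans (sv₁_le_one hp0 hy)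
  have hn : ‖(sv₂ y : ℂ) * μ - μ‖ = 1 - sv₂ y := by
    rw [show (sv₂ y : ℂ) * μ - μ = ((sv₂ y - 1 : ℝ) : ℂ) * μ by push_cast; ring, norm_mul, hμ,
      mul_one, Complex.norm_real, Real.norm_of_nonpos (by linarith)]
    ring
  rw [ex, ey, schattenPow_smul_add_smul_bar he, schattenPow_smul_add_smul_bar he, hn,
    add_right_inj, Real.rpow_left_inj (by linarith) (norm_nonneg _) hp0.ne'] at h4
  refine hsvd.trans (Eq.trans ?_ hsvd'.symm)
  rw [eq_of_norm_sub_eq hν hμ h0 h4.symm]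

/-! ### Real linear extension -/

/-- A complex basis of minimal partial isometries. -/
noncomputable def frame : Fin 4 → Coord :=
  ![![1 / 2, Complex.I / 2, 0, 0], ![1 / 2, -(Complex.I / 2), 0, 0],
    ![0, 0, 1 / 2, Complex.I / 2], ![0, 0, 1 / 2, -(Complex.I / 2)]]

/-- A real basis of minimal partial isometries. -/
noncomputable def realFrame (k : Fin 4 × Fin 2) : Coord :=
  (![1, Complex.I] k.2 : ℂ) • frame k.1

theorem isMinimal_frame (k : Fin 4) : IsMinimal (frame k) := by
  fin_cases k <;> refine ⟨?_, ?_⟩ <;>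
    simp [frame, pair, energy, ip, Fin.sum_univ_four] <;> ring_nf <;> norm_num [Complex.I_sq]

theorem isMinimal_realFrame (k : Fin 4 × Fin 2) : IsMinimal (realFrame k) := by
  refine (isMinimal_frame k.1).smul ?_
  obtain ⟨k, j⟩ := k
  fin_cases j <;> simp

theorem ip_realFrame (k l : Fin 4 × Fin 2) :
    ip (realFrame k) (realFrame l) = if k = l then 1 / 2 else 0 := by
  obtain ⟨k, i⟩ := k
  obtain ⟨l, j⟩ := l
  fin_cases k <;> fin_cases l <;> fin_cases i <;> fin_cases j <;>
    simp [realFrame, frame, ip, Fin.sum_univ_four] <;> norm_num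

/-- The frame is orthogonal with `ip` of each vector with itself equal to 1/2, hence the coefficient
2. -/
theorem sum_realFrame (z : Coord) : ∑ k, (2 * ip (realFrame k) z) • realFrame k = z := by
  ext i
  fin_cases i <;> apply Complex.ext <;>
    simp [Fintype.sum_prod_type, realFrame, frame, ip, Fin.sum_univ_four] <;> ring

theorem ip_eq_sum_realFrame (z w : Coord) :
    ip z w = ∑ k, 2 * ip (realFrame k) z * ip (realFrame k) w := by
  nth_rewrite 1 [← sum_realFrame z]
  simp only [ip_sum_left, ip_smul_left]

/-- A map of the minimal partial isometries that preserves the real inner product is the restriction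
of a real linear isometry. -/
theorem exists_linear_extension {g : Coord → Coord}
    (hip : ∀ e f, IsMinimal e → IsMinimal f → ip (g e) (g f) = ip e f) :
    ∃ T : Coord →ₗ[ℝ] Coord, (∀ e, IsMinimal e → T e = g e) ∧ ∀ z w, ip (T z) (T w) = ip z w := by
  let T : Coord →ₗ[ℝ] Coord :=
    { toFun := fun z => ∑ k, (2 * ip (realFrame k) z) • g (realFrame k)
      map_add' := fun x y => by
        simp only [ip_add_right, mul_add, add_smul, Finset.sum_add_distrib]
      map_smul' := fun c x => by
        simp only [ip_smul_right, Finset.smul_sum, RingHom.id_apply, smul_smul]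
        exact Finset.sum_congr rfl fun k _ => by congr 1; ring }
  have hT : ∀ z w, ip (T z) w = ∑ k, 2 * ip (realFrame k) z * ip (g (realFrame k)) w := fun z w => by
    change ip (∑ k, (2 * ip (realFrame k) z) • g (realFrame k)) w = _
    simp only [ip_sum_left, ip_smul_left]
  have h1 : ∀ k w, ip (T w) (g (realFrame k)) = ip (realFrame k) w := fun k w => by
    rw [hT]
    simp only [hip _ _ (isMinimal_realFrame _) (isMinimal_realFrame _), ip_realFrame]
    simp; ring
  have h2 : ∀ z w, ip (T z) (T w) = ip z w := fun z w => by
    rw [hT, ip_eq_sum_realFrame z w]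
    refine Finset.sum_congr rfl fun k _ => ?_
    rw [ip_comm (g (realFrame k)), h1]
  refine ⟨T, fun e he => ?_, h2⟩
  have h3 : ip (T e) (g e) = ip e e := by
    rw [hT, ip_eq_sum_realFrame e e]
    refine Finset.sum_congr rfl fun k _ => ?_
    rw [hip _ _ (isMinimal_realFrame k) he]
  -- Expanding the energy of T e - g e leaves only inner products already known to agree, so it
  -- vanishes.
  refine sub_eq_zero.1 (energy_eq_zero ?_)
  rw [energy_sub, h3, energy, energy, h2, hip e e he he]
  ring

/-! ### Preservation of the determinant and of the complex structure -/

theorem disc_add_of_minimal {e f : Coord} (he : IsMinimal e) (hf : IsMinimal f) (α β : ℝ) :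
    disc (α • e + β • f) = 2 * |α| * |β| * ‖pair e f‖ := by
  have h : pair ((α : ℂ) • e + (β : ℂ) • f) ((α : ℂ) • e + (β : ℂ) • f)
      = 2 * α * β * pair e f := by
    simp only [pair_add_left, pair_add_right, pair_smul_left, pair_smul_right, he.1, hf.1,
      pair_comm f e]
    ring
  rw [Complex.coe_smul, Complex.coe_smul] at h
  rw [disc, h]
  simp

/-- A singular value decomposition writes z as a real combination of two minimal elements, so |det
z| depends only on the coefficients and on the modulus of their `pair`. -/
theorem disc_linear {T : Coord →ₗ[ℝ] Coord} (hE : ∀ e, IsMinimal e → IsMinimal (T e))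
    (hpair : ∀ e f, IsMinimal e → IsMinimal f → ‖pair (T e) (T f)‖ = ‖pair e f‖) (z : Coord) :
    disc (T z) = disc z := by
  obtain ⟨e, he, μ, hμ, hz⟩ := exists_svd z
  have hf : IsMinimal (μ • bar e) := he.bar.smul hμ
  rw [mul_smul, Complex.coe_smul, Complex.coe_smul] at hz
  have h1 := disc_add_of_minimal he hf (sv₁ z) (sv₂ z)
  have h2 := disc_add_of_minimal (hE e he) (hE _ hf) (sv₁ z) (sv₂ z)
  rw [hpair e _ he hf, ← h1, ← map_smul, ← map_smul, ← map_add, ← hz] at h2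
  exact h2

/-- The value 1/2 is the equality case of Cauchy-Schwarz for f and `bar e`. -/
theorem eq_smul_bar_of_norm_pair {e f : Coord} (he : IsMinimal e) (hf : IsMinimal f)
    (h : ‖pair e f‖ = 1 / 2) : f = (2 * pair e f) • bar e := by
  refine sub_eq_zero.1 (energy_eq_zero ?_)
  rw [energy_sub, ip_self_smul_bar, pair_comm f e, energy_smul, energy_bar, he.2, hf.2, norm_mul, h,
    map_mul, mul_assoc, ← Complex.normSq_eq_conj_mul_self, Complex.normSq_eq_norm_sq, h]
  simp
  norm_num

/-- Both e and i e pair with `bar e` to modulus 1/2, so T e and T(i e) are unimodular multiples of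
the same element `bar (T (bar e))`. Their ratio is ±i because T keeps e and i e orthogonal for the
real inner product. -/
theorem I_smul_of_linear {T : Coord →ₗ[ℝ] Coord} (hE : ∀ e, IsMinimal e → IsMinimal (T e))
    (hip : ∀ z w, ip (T z) (T w) = ip z w)
    (hpair : ∀ e f, IsMinimal e → IsMinimal f → ‖pair (T e) (T f)‖ = ‖pair e f‖) {e : Coord}
    (he : IsMinimal e) :
    T (Complex.I • e) = Complex.I • T e ∨ T (Complex.I • e) = -(Complex.I • T e) := by
  have hIe : IsMinimal (Complex.I • e) := he.smul (by simp)
  have h0 : pair (bar e) e = (1 / 2 : ℝ) := by rw [pair_comm, pair_bar_self, he.2]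
  have n1 : ‖pair (T (bar e)) (T e)‖ = 1 / 2 := by
    rw [hpair _ _ he.bar he, h0, Complex.norm_real]; norm_num
  have n2 : ‖pair (T (bar e)) (T (Complex.I • e))‖ = 1 / 2 := by
    rw [hpair _ _ he.bar hIe, pair_smul_right, h0, norm_mul, Complex.norm_real]; norm_num
  have k1 := eq_smul_bar_of_norm_pair (hE _ he.bar) (hE _ he) n1
  have k2 := eq_smul_bar_of_norm_pair (hE _ he.bar) (hE _ hIe) n2
  set c := 2 * pair (T (bar e)) (T e) with hc
  set d := 2 * pair (T (bar e)) (T (Complex.I • e)) with hd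
  have nc : ‖c‖ = 1 := by rw [hc, norm_mul, n1]; norm_num
  have nd : ‖d‖ = 1 := by rw [hd, norm_mul, n2]; norm_num
  have hcc : conj c * c = 1 := by
    rw [← Complex.normSq_eq_conj_mul_self, Complex.normSq_eq_norm_sq, nc]; simp
  have k3 : T (Complex.I • e) = (d * conj c) • T e := by
    rw [k2, k1, smul_smul, mul_assoc, hcc, mul_one]
  have nl : ‖d * conj c‖ = 1 := by simp [nc, nd]
  have hre : (d * conj c).re = 0 := by
    have h1 := hip (Complex.I • e) e
    have h2 : ip (Complex.I • e) e = 0 := by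
      rw [← pair_bar, pair_smul_left, pair_bar_self]; simp
    rw [h2, k3, ← pair_bar, pair_smul_left, pair_bar_self, (hE e he).2] at h1
    rw [mul_comm, Complex.re_ofReal_mul] at h1
    linarith
  have him : (d * conj c).im = 1 ∨ (d * conj c).im = -1 := by
    have h1 := Complex.sq_norm (d * conj c)
    rw [nl, Complex.normSq_apply, hre] at h1
    exact mul_self_eq_one_iff.1 (by linarith)
  rcases him with h | h
  · left
    rw [k3, show d * conj c = Complex.I from Complex.ext (by simpa using hre) (by simpa using h)]
  · right
    rw [k3, show d * conj c = -Complex.I from Complex.ext (by simpa using hre) (by simpa using h),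
      neg_smul]

/-- The two vanishing conditions make (e + f)/√2 minimal, so the dichotomy applies to it. -/
theorem linear_or_conj_of_add {T : Coord →ₗ[ℝ] Coord} (hE : ∀ e, IsMinimal e → IsMinimal (T e))
    (hip : ∀ z w, ip (T z) (T w) = ip z w)
    (hpair : ∀ e f, IsMinimal e → IsMinimal f → ‖pair (T e) (T f)‖ = ‖pair e f‖) {e f : Coord}
    (he : IsMinimal e) (hf : IsMinimal f) (h : pair e f = 0) (h' : ip e f = 0) :
    T (Complex.I • (e + f)) = Complex.I • T (e + f) ∨
      T (Complex.I • (e + f)) = -(Complex.I • T (e + f)) := by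
  have hs : √(2 : ℝ) ≠ 0 := by positivity
  have hg : IsMinimal ((√2 : ℝ)⁻¹ • (e + f)) := by
    rw [← Complex.coe_smul]
    refine ⟨?_, ?_⟩
    · rw [pair_smul_left, pair_smul_right, pair_add_left, pair_add_right, pair_add_right, he.1, hf.1,
        pair_comm f e, h]
      simp
    · rw [energy_smul, energy_add, he.2, hf.2, h', Complex.norm_real, Real.norm_eq_abs, sq_abs,
        inv_pow, Real.sq_sqrt zero_le_two]
      norm_num
  have h2 := I_smul_of_linear hE hip hpair hg
  rw [smul_comm Complex.I, map_smul T (√2)⁻¹, map_smul T (√2)⁻¹, smul_comm Complex.I,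
    ← smul_neg] at h2
  exact h2.imp (fun h => smul_right_injective _ (inv_ne_zero hs) h)
    fun h => smul_right_injective _ (inv_ne_zero hs) h

/-- Opposite signs at e and f would contradict the single sign at e + f, by forcing i T e or i T f
to vanish. -/
theorem I_smul_of_pair_eq_zero {T : Coord →ₗ[ℝ] Coord} (hE : ∀ e, IsMinimal e → IsMinimal (T e))
    (hip : ∀ z w, ip (T z) (T w) = ip z w)
    (hpair : ∀ e f, IsMinimal e → IsMinimal f → ‖pair (T e) (T f)‖ = ‖pair e f‖) {e f : Coord}
    (he : IsMinimal e) (hf : IsMinimal f) (h : pair e f = 0) (h' : ip e f = 0) {s : ℂ}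
    (hs : s = Complex.I ∨ s = -Complex.I) (hTe : T (Complex.I • e) = s • T e) :
    T (Complex.I • f) = s • T f := by
  have ne : T e ≠ 0 := fun h0 => by
    have := (hE e he).2
    rw [h0] at this; simp [energy, ip] at this
  have k1 := I_smul_of_linear hE hip hpair hf
  have k2 := linear_or_conj_of_add hE hip hpair he hf h h'
  rw [smul_add, map_add, map_add, hTe, smul_add] at k2
  have key : ∀ x : Coord, x + x = 0 → x = 0 := fun x hx => by
    rw [← two_smul ℂ x] at hx
    exact (smul_eq_zero.1 hx).resolve_left two_ne_zero
  have nI : Complex.I • T e ≠ 0 := smul_ne_zero Complex.I_ne_zero ne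
  have nf : Complex.I • T f ≠ 0 := smul_ne_zero Complex.I_ne_zero fun h0 => by
    have := (hE f hf).2
    rw [h0] at this; simp [energy, ip] at this
  rcases hs with rfl | rfl
  · refine k1.resolve_right fun k1 => ?_
    rw [k1] at k2
    rcases k2 with k2 | k2
    · refine nf (key _ ?_)
      rw [add_right_inj] at k2
      nth_rewrite 1 [← k2]
      exact neg_add_cancel _
    · refine nI (key _ ?_)
      rw [neg_add, add_left_inj] at k2
      nth_rewrite 1 [k2]
      exact neg_add_cancel _
  · rw [neg_smul] at k2 ⊢
    refine k1.resolve_left fun k1 => ?_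
    rw [k1] at k2
    rcases k2 with k2 | k2
    · refine nI (key _ ?_)
      rw [add_left_inj] at k2
      nth_rewrite 1 [← k2]
      exact neg_add_cancel _
    · refine nf (key _ ?_)
      rw [neg_add, add_right_inj] at k2
      nth_rewrite 1 [k2]
      exact neg_add_cancel _

theorem linear_or_conj {T : Coord →ₗ[ℝ] Coord} (hE : ∀ e, IsMinimal e → IsMinimal (T e))
    (hip : ∀ z w, ip (T z) (T w) = ip z w)
    (hpair : ∀ e f, IsMinimal e → IsMinimal f → ‖pair (T e) (T f)‖ = ‖pair e f‖) :
    (∀ z, T (Complex.I • z) = Complex.I • T z) ∨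
      ∀ z, T (Complex.I • z) = -Complex.I • T z := by
  have main : ∀ s : ℂ, (s = Complex.I ∨ s = -Complex.I) →
      T (Complex.I • frame 0) = s • T (frame 0) → ∀ z, T (Complex.I • z) = s • T z := by
    intro s hs h0 z
    have hss : s * s = -1 := by rcases hs with rfl | rfl <;> simp
    have st : ∀ k l, pair (frame k) (frame l) = 0 → ip (frame k) (frame l) = 0 →
        T (Complex.I • frame k) = s • T (frame k) → T (Complex.I • frame l) = s • T (frame l) :=
      fun k l a b c => I_smul_of_pair_eq_zero hE hip hpair (isMinimal_frame k) (isMinimal_frame l) a b hs c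
    have h2 := st 0 2 (by simp [frame, pair, Fin.sum_univ_four])
      (by simp [frame, ip, Fin.sum_univ_four]) h0
    have h3 := st 0 3 (by simp [frame, pair, Fin.sum_univ_four])
      (by simp [frame, ip, Fin.sum_univ_four]) h0
    -- The vectors `frame 0` and `frame 1` are conjugate, with nonzero `pair`, so the sign passes
    -- from 0 to 1 through 2.
    have h1 := st 2 1 (by simp [frame, pair, Fin.sum_univ_four])
      (by simp [frame, ip, Fin.sum_univ_four]) h2
    have hk : ∀ k, T (Complex.I • frame k) = s • T (frame k) := by
      intro k
      fin_cases k
      exacts [h0, h1, h2, h3]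
    have hr : ∀ k, T (Complex.I • realFrame k) = s • T (realFrame k) := by
      rintro ⟨k, j⟩
      fin_cases j
      · simpa [realFrame] using hk k
      · simp only [realFrame, Fin.mk_one, Matrix.cons_val_one, Matrix.cons_val_fin_one, hk k,
          smul_smul, hss, Complex.I_mul_I]
        rw [neg_one_smul, neg_one_smul, map_neg]
    rw [← sum_realFrame z, Finset.smul_sum, map_sum, map_sum, Finset.smul_sum]
    refine Finset.sum_congr rfl fun k _ => ?_
    rw [smul_comm Complex.I, map_smul T (2 * _), map_smul T (2 * _), hr, smul_comm s]
  rcases I_smul_of_linear hE hip hpair (isMinimal_frame 0) with h | h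
  · exact Or.inl (main _ (Or.inl rfl) h)
  · exact Or.inr (main _ (Or.inr rfl) (by rw [h, neg_smul]))

/-! ### The extension theorem in coordinates -/

/-- Tingley's theorem in coordinates. -/
theorem exists_isometry_extension {p : ℝ} (hp : 1 < p) (hp2 : p ≠ 2) {g : Coord → Coord}
    (hg : ∀ z, schattenPow p z = 1 → schattenPow p (g z) = 1)
    (hiso : ∀ z w, schattenPow p z = 1 → schattenPow p w = 1 →
      schattenPow p (g z - g w) = schattenPow p (z - w)) :
    ∃ T : Coord →ₗ[ℝ] Coord, Function.Surjective T ∧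
      (∀ z, schattenPow p (T z) = schattenPow p z) ∧ (∀ z, schattenPow p z = 1 → T z = g z) ∧
      ((∀ z, T (Complex.I • z) = Complex.I • T z) ∨
        ∀ z, T (Complex.I • z) = -Complex.I • T z) := by
  have hp0 : 0 < p := by linarith
  have hneg : ∀ z, schattenPow p z = 1 → g (-z) = -g z := fun z hz => by
    have hz' : schattenPow p (-z) = 1 := by rw [schattenPow_neg, hz]
    -- Antipodal points are exactly those at distance 2, by strict convexity.
    refine eq_neg_of_schattenPow_sub hp (hg z hz) (hg _ hz') ?_
    rw [hiso _ _ hz hz', sub_neg_eq_add, ← two_smul ℂ, schattenPow_smul, hz]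
    simp
  have hadd : ∀ z w, schattenPow p z = 1 → schattenPow p w = 1 →
      schattenPow p (g z + g w) = schattenPow p (z + w) := fun z w hz hw => by
    have hw' : schattenPow p (-w) = 1 := by rw [schattenPow_neg, hw]
    have := hiso z (-w) hz hw'
    rwa [hneg w hw, sub_neg_eq_add, sub_neg_eq_add] at this
  have h1 : ∀ e, IsMinimal e → schattenPow p e = 1 := fun e he => he.schattenPow hp0.ne'
  have hE : ∀ e, IsMinimal e → IsMinimal (g e) := fun e he => by
    -- The partner `bar e` attains equality in Clarkson-McCarthy, 2 + 2 = 4, and the equality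
    -- transfers to the images.
    have hb := h1 _ he.bar
    obtain ⟨k1, k2⟩ := he.schattenPow_add_sub_bar p
    refine isMinimal_of_disc_eq_zero hp0 (disc_eq_zero_of_clarkson hp0 hp2 (hg e (h1 e he))
      (hg _ hb) ?_) (hg e (h1 e he))
    rw [hadd _ _ (h1 e he) hb, hiso _ _ (h1 e he) hb, k1, k2]
    norm_num
  have hpre : ∀ e f, IsMinimal e → IsMinimal f →
      ip (g e) (g f) = ip e f ∧ ‖pair (g e) (g f)‖ = ‖pair e f‖ := fun e f he hf =>
    IsMinimal.ip_eq_and_norm_pair_eq hp0 hp2 (hE e he) (hE f hf) he hf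
      (hiso e f (h1 e he) (h1 f hf)) (hadd e f (h1 e he) (h1 f hf))
  obtain ⟨T, hTg, hip⟩ := exists_linear_extension fun e f he hf => (hpre e f he hf).1
  have hTE : ∀ e, IsMinimal e → IsMinimal (T e) := fun e he => by rw [hTg e he]; exact hE e he
  have hTpair : ∀ e f, IsMinimal e → IsMinimal f → ‖pair (T e) (T f)‖ = ‖pair e f‖ :=
    fun e f he hf => by rw [hTg e he, hTg f hf]; exact (hpre e f he hf).2
  have hN : ∀ z, schattenPow p (T z) = schattenPow p z := fun z =>
    schattenPow_congr (hip z z) (disc_linear hTE hTpair z)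
  have hinj : Function.Injective T := by
    refine (injective_iff_map_eq_zero T).2 fun z hz => energy_eq_zero ?_
    rw [energy, ← hip, hz]; simp [ip]
  have hsurj : Function.Surjective T := LinearMap.surjective_of_injective hinj
  refine ⟨T, hsurj, hN, fun z hz => ?_, linear_or_conj hTE hip hTpair⟩
  obtain ⟨y, hy⟩ := hsurj (g z)
  have hy1 : schattenPow p y = 1 := by rw [← hN, hy, hg z hz]
  rw [← hy]
  congr 1
  -- The preimage y of g z under T has the same distances as z to all minimal elements, since T and
  -- g agree on these.
  refine eq_of_forall_isMinimal hp hz hy1 fun e he => ?_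
  rw [← hiso z e hz (h1 e he), ← hN (y - e), map_sub, hy, hTg e he]

/-! ### From operators to coordinates -/

/-- The complex linear coordinates on the two by two matrices in which the determinant is
`∑ i, z i ^ 2`. -/
noncomputable def matrixEquiv : Matrix (Fin 2) (Fin 2) ℂ ≃ₗ[ℂ] Coord where
  toFun m := ![(m 0 0 + m 1 1) / 2, -Complex.I * (m 0 0 - m 1 1) / 2, (m 0 1 - m 1 0) / 2,
    -Complex.I * (m 0 1 + m 1 0) / 2]
  invFun z := !![z 0 + Complex.I * z 1, z 2 + Complex.I * z 3;
    -z 2 + Complex.I * z 3, z 0 - Complex.I * z 1]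
  map_add' m n := by
    ext i; fin_cases i <;> simp <;> ring
  map_smul' c m := by
    ext i; fin_cases i <;> simp <;> ring
  left_inv m := by
    ext i j; fin_cases i <;> fin_cases j <;> simp <;> ring_nf <;> simp [Complex.I_sq] <;> ring
  right_inv z := by
    ext i; fin_cases i <;> simp <;> ring_nf <;> simp [Complex.I_sq]

theorem pair_matrixEquiv (m : Matrix (Fin 2) (Fin 2) ℂ) :
    pair (matrixEquiv m) (matrixEquiv m) = m.det := by
  simp [matrixEquiv, pair, Fin.sum_univ_four, Matrix.det_fin_two]
  ring_nf
  simp [Complex.I_sq]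
  ring

theorem energy_matrixEquiv (m : Matrix (Fin 2) (Fin 2) ℂ) :
    ((2 * energy (matrixEquiv m) : ℝ) : ℂ) = (m.conjTranspose * m).trace := by
  apply Complex.ext
  · simp [matrixEquiv, energy, ip, Fin.sum_univ_four, Matrix.trace_fin_two, Matrix.mul_apply,
      Fin.sum_univ_two]
    ring
  · simp [matrixEquiv, energy, ip, Fin.sum_univ_four, Matrix.trace_fin_two, Matrix.mul_apply,
      Fin.sum_univ_two]
    ring

section Hilbert

variable {H : Type*} [NormedAddCommGroup H] [InnerProductSpace ℂ H] [FiniteDimensional ℂ H]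

/-- The coordinates of an operator in an orthonormal basis. -/
noncomputable def coordEquiv (b : OrthonormalBasis (Fin 2) ℂ H) : (H →ₗ[ℂ] H) ≃ₗ[ℂ] Coord :=
  (LinearMap.toMatrix b.toBasis b.toBasis).trans matrixEquiv

/-- Both sides are the trace of a⋆a; the companion for the product compares its determinant.
Together they identify the two singular values. -/
theorem singularValues_sq_add (b : OrthonormalBasis (Fin 2) ℂ H) (a : H →ₗ[ℂ] H) :
    a.singularValues 0 ^ 2 + a.singularValues 1 ^ 2 = 2 * energy (coordEquiv b a) := by
  have hH : Module.finrank ℂ H = 2 := by simpa using Module.finrank_eq_card_basis b.toBasis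
  have h := a.isSymmetric_adjoint_comp_self.trace_eq_sum_eigenvalues hH
  rw [LinearMap.trace_eq_matrix_trace ℂ b.toBasis, LinearMap.toMatrix_comp b.toBasis b.toBasis,
    LinearMap.toMatrix_adjoint, ← energy_matrixEquiv, Fin.sum_univ_two,
    ← a.sq_singularValues_fin hH, ← a.sq_singularValues_fin hH] at h
  norm_cast at h
  exact (Complex.ofReal_injective h).symm

theorem singularValues_mul (b : OrthonormalBasis (Fin 2) ℂ H) (a : H →ₗ[ℂ] H) :
    a.singularValues 0 * a.singularValues 1 = disc (coordEquiv b a) := by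
  have hH : Module.finrank ℂ H = 2 := by simpa using Module.finrank_eq_card_basis b.toBasis
  have h := a.isSymmetric_adjoint_comp_self.det_eq_prod_eigenvalues hH
  rw [← LinearMap.det_toMatrix b.toBasis, LinearMap.toMatrix_comp b.toBasis b.toBasis,
    LinearMap.toMatrix_adjoint, Matrix.det_mul, Matrix.det_conjTranspose, Fin.prod_univ_two,
    ← a.sq_singularValues_fin hH, ← a.sq_singularValues_fin hH, ← pair_matrixEquiv, ← starRingEnd_apply,
    ← Complex.normSq_eq_conj_mul_self, Complex.normSq_eq_norm_sq] at h
  refine (sq_eq_sq₀ (mul_nonneg (a.singularValues_nonneg 0) (a.singularValues_nonneg 1))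
    (disc_nonneg _)).1 ?_
  rw [mul_pow]
  norm_cast at h
  exact (Complex.ofReal_injective h).symm

theorem schattenNorm_eq (b : OrthonormalBasis (Fin 2) ℂ H) (p : ℝ) (a : H →ₗ[ℂ] H) :
    schattenNorm p a = schattenPow p (coordEquiv b a) ^ (1 / p) := by
  have hH : Module.finrank ℂ H = 2 := by simpa using Module.finrank_eq_card_basis b.toBasis
  rw [schattenNorm, hH, Finset.sum_range_succ, Finset.sum_range_one,
    schattenPow_eq (a.singularValues_nonneg 0) (a.singularValues_nonneg 1)
      (singularValues_sq_add b a) (singularValues_mul b a)]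

theorem schattenPow_nonneg (p : ℝ) (z : Coord) : 0 ≤ schattenPow p z :=
  add_nonneg (Real.rpow_nonneg (sv₁_nonneg z) p) (Real.rpow_nonneg (sv₂_nonneg z) p)

theorem schattenNorm_eq_iff (b : OrthonormalBasis (Fin 2) ℂ H) {p : ℝ} (hp : 0 < p)
    (x y : H →ₗ[ℂ] H) : schattenNorm p x = schattenNorm p y ↔
      schattenPow p (coordEquiv b x) = schattenPow p (coordEquiv b y) := by
  rw [schattenNorm_eq b, schattenNorm_eq b, Real.rpow_left_inj (schattenPow_nonneg _ _)
    (schattenPow_nonneg _ _) (by positivity)]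

theorem schattenNorm_eq_one_iff (b : OrthonormalBasis (Fin 2) ℂ H) {p : ℝ} (hp : 0 < p)
    (x : H →ₗ[ℂ] H) : schattenNorm p x = 1 ↔ schattenPow p (coordEquiv b x) = 1 := by
  rw [schattenNorm_eq b, ← Real.rpow_left_inj (schattenPow_nonneg _ _) zero_le_one
    (show 1 / p ≠ 0 by positivity), Real.one_rpow]

end Hilbert

theorem smul_of_I_smul {T : Coord →ₗ[ℝ] Coord} {s : ℂ}
    (h : ∀ z, T (Complex.I • z) = s • T z) (c : ℂ) (z : Coord) :
    T (c • z) = (c.re + c.im * s) • T z := by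
  have h1 : c • z = c.re • z + c.im • (Complex.I • z) := by
    rw [← Complex.coe_smul, ← Complex.coe_smul, smul_smul, ← add_smul, Complex.re_add_im]
  rw [h1, map_add, map_smul T c.re, map_smul T c.im, h, add_smul, mul_smul, Complex.coe_smul,
    Complex.coe_smul]

end SpinFactor

theorem theoremt {H : Type*} [NormedAddCommGroup H] [InnerProductSpace ℂ H]
    [FiniteDimensional ℂ H] (hH : Module.finrank ℂ H = 2)
    (p : ℝ) (hp1 : 1 < p) (hp2 : p ≠ 2)
    (Δ : schattenSphere H p → schattenSphere H p)
    (hsurj : Function.Surjective Δ)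
    (hiso : ∀ a b : schattenSphere H p,
      schattenNorm p ((Δ a : H →ₗ[ℂ] H) - (Δ b : H →ₗ[ℂ] H)) =
        schattenNorm p ((a : H →ₗ[ℂ] H) - (b : H →ₗ[ℂ] H))) :
    (∃ T : (H →ₗ[ℂ] H) →ₗ[ℂ] (H →ₗ[ℂ] H),
      Function.Surjective T ∧
      (∀ a b : H →ₗ[ℂ] H, schattenNorm p (T a - T b) = schattenNorm p (a - b)) ∧
      ∀ a : schattenSphere H p, T (a : H →ₗ[ℂ] H) = (Δ a : H →ₗ[ℂ] H)) ∨
    (∃ T : (H →ₗ[ℂ] H) →ₛₗ[starRingEnd ℂ] (H →ₗ[ℂ] H),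
      Function.Surjective T ∧
      (∀ a b : H →ₗ[ℂ] H, schattenNorm p (T a - T b) = schattenNorm p (a - b)) ∧
      ∀ a : schattenSphere H p, T (a : H →ₗ[ℂ] H) = (Δ a : H →ₗ[ℂ] H)) := by
  have hp0 : 0 < p := by linarith
  let b : OrthonormalBasis (Fin 2) ℂ H := (stdOrthonormalBasis ℂ H).reindex (finCongr hH)
  let κ : (H →ₗ[ℂ] H) ≃ₗ[ℂ] SpinFactor.Coord := SpinFactor.coordEquiv b
  have hκ : ∀ z : SpinFactor.Coord, SpinFactor.schattenPow p z = 1 →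
      schattenNorm p (κ.symm z) = 1 := fun z hz => by
    rw [SpinFactor.schattenNorm_eq_one_iff b hp0]
    change SpinFactor.schattenPow p (κ (κ.symm z)) = 1
    rw [κ.apply_symm_apply, hz]
  classical
  let g : SpinFactor.Coord → SpinFactor.Coord := fun z =>
    if hz : SpinFactor.schattenPow p z = 1 then κ (Δ ⟨κ.symm z, hκ z hz⟩) else 0
  have hgΔ : ∀ z (hz : SpinFactor.schattenPow p z = 1), g z = κ (Δ ⟨κ.symm z, hκ z hz⟩) :=
    fun z hz => dif_pos hz
  obtain ⟨T, hTs, hTN, hTg, hTI⟩ := SpinFactor.exists_isometry_extension hp1 hp2 (g := g)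
    (fun z hz => by
      rw [hgΔ z hz]
      exact (SpinFactor.schattenNorm_eq_one_iff b hp0 _).1 (Δ _).2)
    (fun z w hz hw => by
      rw [hgΔ z hz, hgΔ w hw, ← map_sub]
      have := (SpinFactor.schattenNorm_eq_iff b hp0 _ _).1 (hiso ⟨κ.symm z, hκ z hz⟩
        ⟨κ.symm w, hκ w hw⟩)
      refine this.trans ?_
      change SpinFactor.schattenPow p (κ (κ.symm z - κ.symm w)) = _
      rw [map_sub, κ.apply_symm_apply, κ.apply_symm_apply])
  have hsurjT : Function.Surjective fun a => κ.symm (T (κ a)) :=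
    κ.symm.surjective.comp (hTs.comp κ.surjective)
  have hnorm : ∀ x y : H →ₗ[ℂ] H,
      schattenNorm p (κ.symm (T (κ x)) - κ.symm (T (κ y))) = schattenNorm p (x - y) := fun x y => by
    rw [SpinFactor.schattenNorm_eq_iff b hp0]
    change SpinFactor.schattenPow p (κ _) = SpinFactor.schattenPow p (κ _)
    rw [map_sub, κ.apply_symm_apply, κ.apply_symm_apply, ← map_sub, hTN, map_sub]
  have hΔ : ∀ a : schattenSphere H p, κ.symm (T (κ a)) = (Δ a : H →ₗ[ℂ] H) := fun a => by
    have ha : SpinFactor.schattenPow p (κ a) = 1 :=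
      (SpinFactor.schattenNorm_eq_one_iff b hp0 _).1 a.2
    rw [hTg _ ha, hgΔ _ ha, κ.symm_apply_apply]
    simp only [κ.symm_apply_apply]
  rcases hTI with hTI | hTI
  · refine Or.inl ⟨{ toFun := fun a => κ.symm (T (κ a)), map_add' := ?_, map_smul' := ?_ },
      hsurjT, hnorm, hΔ⟩
    · intro x y
      simp only [map_add]
    · intro c x
      rw [map_smul κ, SpinFactor.smul_of_I_smul hTI, Complex.re_add_im, map_smul κ.symm,
        RingHom.id_apply]
  · refine Or.inr ⟨{ toFun := fun a => κ.symm (T (κ a)), map_add' := ?_, map_smul' := ?_ },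
      hsurjT, hnorm, hΔ⟩
    · intro x y
      simp only [map_add]
    · intro c x
      rw [map_smul κ, SpinFactor.smul_of_I_smul hTI, map_smul κ.symm]
      congr 1
      -- Here s = -i, so re c + (im c) s is the conjugate of c.
      apply Complex.ext <;> simp
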